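/- **Theorem 3.5.** Let $f(z)=\sum_{k=0}^{\infty}a_kz^k$ be a formal power series with real coefficients. For $n=0,1,2,\dots$ let $$A(f,n)(z)=\sum_{k=0}^{n}\frac{n!}{(n-k)!}\,a_k z^{n-k}$$ be its $n$-th Appell polynomial. Put $S_0=[0,\infty)\subset\mathbb C$. For an entire function $F\not\equiv 0$ and $X\subset\mathbb C$ let $N(F;X)\in\{0,1,2,\dots,\infty\}$ be the number of zeros of $F$ in $X$ counted with multiplicity, put $N(0;X)=0$, and let $N_n=N(A(f,n);\mathbb C\setminus S_0)$. Let $\mathcal{LP}(S_0)$ be the class of real entire functions (entire functions that are real on $\mathbb R$) of the form $$g(z)=c\,z^m e^{-\alpha z}\prod_j\Bigl(1-\frac{z}{a_j}\Bigr),$$ where $c\in\mathbb R$, $m$ is a nonnegative integer, $\alpha\ge 0$, and $(a_j)$ is a finite (possibly empty) or infinite sequence of positive numbers with $\sum_j a_j^{-1}<\infty$. Let $\mathcal{LP}(S_0)^*$ be the class of real entire functions of the form $Pg$ with $P$ a real polynomial and $g\in\mathcal{LP}(S_0)$. The series $f$ is said to represent an entire function $F$ if it converges to $F(z)$ for every $z\in\mathbb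 C$. Then: 1. $0=N_0\le N_1\le N_2\le\cdots$. 2. If $f$ represents an entire function $F\in\mathcal{LP}(S_0)^*$ and $N=N(F;\mathbb C\setminus S_0)$, then $N_n\le N$ for all $n$, and $N_n=N$ for all sufficiently large $n$. 3. If the sequence $\langle N_n\rangle$ is bounded, then $f$ represents an entire function in $\mathcal{LP}(S_0)^*$. -/

import Mathlib

namespace PolyaAppell

noncomputable section

/-- `S₀ = [0, ∞)`, as a subset of the complex plane. -/
def S₀ : Set ℂ := {z : ℂ | 0 ≤ z.re ∧ z.im = 0}

open Classical in
/-- `N(F; X)`: the number of zeros of `F` lying in `X`, counted with multiplicity, as an element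
of `ℕ ∪ {∞}`; it is `0` by convention when `F` vanishes identically. The multiplicity of a point
is the order of vanishing, which is `0` at a point that is not a zero. -/
def zeroCount (F : ℂ → ℂ) (X : Set ℂ) : ℕ∞ :=
  if F = 0 then 0 else ∑' z : X, analyticOrderAt F (z : ℂ)

/-- The value of a real polynomial at a complex number. -/
def evalC (P : Polynomial ℝ) (z : ℂ) : ℂ := Polynomial.aeval z P

/-- The `n`-th Appell polynomial `A(f, n) = ∑_{k=0}^{n} n!/(n-k)! a_k z^{n-k}` of the formal power
series `f = ∑ a_k z^k`. -/
def appell (f : PowerSeries ℝ) (n : ℕ) : Polynomial ℝ :=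
  ∑ k ∈ Finset.range (n + 1),
    Polynomial.monomial (n - k)
      ((n.factorial : ℝ) / ((n - k).factorial : ℝ) * PowerSeries.coeff k f)

/-- `N_n = N(A(f, n); ℂ ∖ S₀)`. -/
def appellCount (f : PowerSeries ℝ) (n : ℕ) : ℕ∞ :=
  zeroCount (evalC (appell f n)) S₀ᶜ

/-- The formal power series `f` represents the entire function `F`: it converges to `F` at every
point of the complex plane. -/
def Represents (f : PowerSeries ℝ) (F : ℂ → ℂ) : Prop :=
  ∀ z : ℂ, HasSum (fun k : ℕ => ((PowerSeries.coeff k f : ℝ) : ℂ) * z ^ k) (F z)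

/-- A real entire function: entire, and real on the real axis. -/
def IsRealEntire (F : ℂ → ℂ) : Prop :=
  Differentiable ℂ F ∧ ∀ x : ℝ, (F x).im = 0

/-- The class `LP(S₀)` of the real entire functions
`c z^m e^{-α z} ∏_j (1 - z / a_j)` with `c` real, `m` a nonnegative integer, `α ≥ 0`, and `(a_j)` a
finite (possibly empty) or infinite sequence of positive reals with `∑_j 1 / a_j < ∞`. -/
def LP : Set (ℂ → ℂ) :=
  {g | IsRealEntire g ∧
    ∃ (c : ℝ) (m : ℕ) (α : ℝ) (ι : Type) (_ : Countable ι) (a : ι → ℝ),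
      0 ≤ α ∧ (∀ j, 0 < a j) ∧ Summable (fun j => (a j)⁻¹) ∧
      ∀ z : ℂ, ∃ p : ℂ, HasProd (fun j => 1 - z / (a j : ℂ)) p ∧
        g z = (c : ℂ) * z ^ m * Complex.exp (-(α : ℂ) * z) * p}

/-- The class `LP(S₀)*` of the real entire functions `P g` with `P` a real polynomial and
`g ∈ LP(S₀)`. -/
def LPStar : Set (ℂ → ℂ) :=
  {F | IsRealEntire F ∧ ∃ (P : Polynomial ℝ), ∃ g ∈ LP, ∀ z : ℂ, F z = evalC P z * g z}

end

end PolyaAppell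

namespace PolyaAppell

open Polynomial Filter Topology

/-! ### Counting the roots of a real polynomial outside `[0, ∞)` -/

/-! The proof stays with real polynomials: `outerCount` is the number of zeros outside `[0, ∞)`. It
does not increase under differentiation (Rolle on `[0, ∞)`), under reversal `x^n p(1/x)`, or under a
positive rescaling of the variable. Since `A(f, n+1)' = (n+1) A(f, n)`, monotonicity of `N_n` is
immediate.

The analytic core is the compactness theorem `exists_represents_of_tendsto_coeff`: coefficientwise
limits of polynomials with a common order at `0` and at most `B` outer zeros lie in `LPStar`, again
with at most `B` outer zeros. After normalization, such a polynomial is `∏ (1 - y x) · Q` with all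
`y > 0`, `Q(0) = 1` and `deg Q ≤ B`. The linear coefficient controls the sum of the reciprocal roots
up to `B` times the largest of them, and `exists_root_bound` bounds that one by finitely many
coefficients. Then all coefficients are dominated by `S^k / k!`, the products converge to some
`e^{-αz} ∏ (1 - Y_j z)` along an ultrafilter, and `Q` converges to a polynomial of degree at most
`B`. No Hurwitz argument is needed: the zero count of the limit is read off its polynomial factor.

For part (3), the reversed Appell polynomials evaluated at `x/n` have coefficients
`n(n-1)⋯(n-k+1)/n^k · a_k`, which tend to `a_k`; compactness applies.

For part (2), let `F = P g`. Approximating `g` by polynomials with only nonnegative zeros makes `f`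
a limit of polynomials with at most `outerCount P` outer zeros. Reversal, repeated differentiation,
reversal and rescaling turn these into polynomials converging to the reversed `A(f, n)`, so
compactness gives `N_n ≤ outerCount P ≤ N`. The bounded sequence `N_n` attains its maximum; part (3)
with that maximum as bound gives `N ≤ max N_n`, hence eventual equality. -/

/-- The number of complex roots outside `[0, ∞)`: the degree minus the number of nonnegative
roots. -/
noncomputable def outerCount (p : ℝ[X]) : ℕ :=
  p.natDegree - Multiset.card (p.roots.filter (0 ≤ ·))

/-- The polynomial `∏ (1 - y X)` over a multiset of scalars `y`. -/
noncomputable def invProd {R : Type*} [CommRing R] (s : Multiset R) : R[X] :=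
  (s.map fun y => 1 - C y * X).prod

/-- Rolle's theorem with multiplicities: a root of multiplicity `m` survives with multiplicity at
least `m - 1`, and between consecutive distinct nonnegative roots there is a new root of the
derivative, again nonnegative. -/
theorem card_filter_roots_le_derivative (p : ℝ[X]) :
    Multiset.card (p.roots.filter (0 ≤ ·)) ≤
      Multiset.card ((derivative p).roots.filter (0 ≤ ·)) + 1 := by
  rcases eq_or_ne (derivative p) 0 with hp' | hp'
  · rw [eq_C_of_derivative_eq_zero hp']
    simp
  have hp : p ≠ 0 := ne_of_apply_ne derivative (by rwa [derivative_zero])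
  set s := (p.roots.filter (0 ≤ ·)).toFinset with hs
  set t := ((derivative p).roots.filter (0 ≤ ·)).toFinset with ht
  have key : s.card ≤ (t \ s).card + 1 := by
    refine Finset.card_le_sdiff_of_interleaved fun x hx y hy hxy hxy' => ?_
    rw [Multiset.mem_toFinset, Multiset.mem_filter, mem_roots hp] at hx hy
    obtain ⟨z, hz1, hz2⟩ := exists_deriv_eq_zero hxy p.continuousOn (hx.1.trans hy.1.symm)
    refine ⟨z, ?_, hz1⟩
    rw [Multiset.mem_toFinset, Multiset.mem_filter, mem_roots hp', IsRoot, ← p.deriv]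
    exact ⟨hz2, hx.2.trans hz1.1.le⟩
  calc
    Multiset.card (p.roots.filter (0 ≤ ·))
      = ∑ x ∈ s, (p.roots.filter (0 ≤ ·)).count x := (Multiset.toFinset_sum_count_eq _).symm
    _ = ∑ x ∈ s, ((p.roots.filter (0 ≤ ·)).count x - 1 + 1) :=
      (Eq.symm <| Finset.sum_congr rfl fun _ hx => tsub_add_cancel_of_le <|
        Nat.succ_le_iff.2 <| Multiset.count_pos.2 <| Multiset.mem_toFinset.1 hx)
    _ = (∑ x ∈ s, ((p.roots.filter (0 ≤ ·)).count x - 1)) + s.card := by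
      simp only [Finset.sum_add_distrib, Finset.card_eq_sum_ones]
    _ ≤ (∑ x ∈ s, ((derivative p).roots.filter (0 ≤ ·)).count x) +
          ((∑ x ∈ t \ s, ((derivative p).roots.filter (0 ≤ ·)).count x) + 1) := by
      refine add_le_add (Finset.sum_le_sum fun x hx => ?_) (key.trans ?_)
      · have hx0 : 0 ≤ x := by
          rw [hs, Multiset.mem_toFinset, Multiset.mem_filter] at hx
          exact hx.2
        rw [Multiset.count_filter_of_pos hx0, Multiset.count_filter_of_pos hx0, count_roots,
          count_roots]
        exact rootMultiplicity_sub_one_le_derivative_rootMultiplicity _ _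
      · rw [Finset.card_eq_sum_ones]
        gcongr with x hx
        rw [Nat.succ_le_iff, Multiset.count_pos, ← Multiset.mem_toFinset]
        exact (Finset.mem_sdiff.1 hx).1
    _ = Multiset.card ((derivative p).roots.filter (0 ≤ ·)) + 1 := by
      rw [← add_assoc, ← Finset.sum_union Finset.disjoint_sdiff, Finset.union_sdiff_self_eq_union,
        ← Multiset.toFinset_sum_count_eq, ← Finset.sum_subset Finset.subset_union_right]
      intro x _ hx₂
      simpa only [ht, Multiset.mem_toFinset, Multiset.count_eq_zero] using hx₂

/-- The degree drops by at least one while at most one nonnegative root is lost. -/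
theorem outerCount_derivative_le (p : ℝ[X]) : outerCount (derivative p) ≤ outerCount p := by
  have h1 := card_filter_roots_le_derivative p
  have h2 := natDegree_derivative_le p
  have h3 : Multiset.card ((derivative p).roots.filter (0 ≤ ·)) ≤ (derivative p).natDegree :=
    (Multiset.card_le_card (Multiset.filter_le _ _)).trans (card_roots' _)
  unfold outerCount
  rcases Nat.eq_zero_or_pos p.natDegree with h | h
  · have : derivative p = 0 := by rw [eq_C_of_natDegree_eq_zero h]; simp
    simp [this]
  · omega

theorem one_sub_C_mul_X (y : ℝ) (hy : y ≠ 0) :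
    (1 - C y * X : ℝ[X]) = C (-y) * (X - C y⁻¹) := by
  rw [mul_sub, ← C_mul, neg_mul, mul_inv_cancel₀ hy]
  simp
  ring

theorem invProd_zero {R : Type*} [CommRing R] : invProd (0 : Multiset R) = 1 := by
  simp [invProd]

theorem invProd_cons {R : Type*} [CommRing R] (y : R) (s : Multiset R) :
    invProd (y ::ₘ s) = (1 - C y * X) * invProd s := by simp [invProd]

theorem invProd_add {R : Type*} [CommRing R] (s t : Multiset R) :
    invProd (s + t) = invProd s * invProd t := by
  simp [invProd]

theorem map_invProd {R S : Type*} [CommRing R] [CommRing S] (φ : R →+* S) (s : Multiset R) :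
    (invProd s).map φ = invProd (s.map φ) := by
  induction s using Multiset.induction_on with
  | empty => simp [invProd_zero]
  | cons y s ih => simp [invProd_cons, ih]

theorem coeff_zero_invProd {R : Type*} [CommRing R] (s : Multiset R) : (invProd s).coeff 0 = 1 := by
  induction s using Multiset.induction_on with
  | empty => simp [invProd_zero]
  | cons y s ih => simp [invProd_cons, mul_coeff_zero, ih]

theorem invProd_ne_zero (s : Multiset ℝ) : invProd s ≠ 0 := fun h => by
  simpa [h] using coeff_zero_invProd s

theorem invProd_eq_C_mul {s : Multiset ℝ} (hs : ∀ y ∈ s, 0 < y) :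
    ∃ c : ℝ, c ≠ 0 ∧ invProd s = C c * ((s.map (·⁻¹)).map fun a => X - C a).prod := by
  induction s using Multiset.induction_on with
  | empty => exact ⟨1, one_ne_zero, by simp [invProd_zero]⟩
  | cons y s ih =>
    obtain ⟨c, hc, h⟩ := ih fun z hz => hs z (Multiset.mem_cons_of_mem hz)
    have hy := hs y (Multiset.mem_cons_self y s)
    refine ⟨-y * c, mul_ne_zero (neg_ne_zero.2 hy.ne') hc, ?_⟩
    rw [invProd_cons, h, one_sub_C_mul_X y hy.ne', C_mul, Multiset.map_cons, Multiset.map_cons,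
      Multiset.prod_cons]
    ring

theorem natDegree_invProd {s : Multiset ℝ} (hs : ∀ y ∈ s, 0 < y) :
    (invProd s).natDegree = Multiset.card s := by
  obtain ⟨c, hc, h⟩ := invProd_eq_C_mul hs
  rw [h, natDegree_C_mul hc, natDegree_multiset_prod_X_sub_C_eq_card]
  simp

theorem roots_invProd {s : Multiset ℝ} (hs : ∀ y ∈ s, 0 < y) :
    (invProd s).roots = s.map (·⁻¹) := by
  obtain ⟨c, hc, h⟩ := invProd_eq_C_mul hs
  rw [h, roots_C_mul _ hc, roots_multiset_prod_X_sub_C]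

theorem outerCount_mul_le {s : Multiset ℝ} (hs : ∀ y ∈ s, 0 < y) (m : ℕ) {Q : ℝ[X]}
    (hQ : Q ≠ 0) : outerCount (X ^ m * invProd s * Q) ≤ Q.natDegree := by
  have h1 : (X ^ m * invProd s : ℝ[X]) ≠ 0 :=
    mul_ne_zero (pow_ne_zero _ X_ne_zero) (invProd_ne_zero s)
  have h2 : (X ^ m * invProd s : ℝ[X]).roots = m • {0} + s.map (·⁻¹) := by
    rw [roots_mul h1, roots_invProd hs, roots_X_pow]
  have h3 : (X ^ m * invProd s : ℝ[X]).roots.filter (0 ≤ ·) = m • {0} + s.map (·⁻¹) := by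
    rw [h2, Multiset.filter_eq_self]
    intro a ha
    rcases Multiset.mem_add.1 ha with h | h
    · exact (Multiset.mem_singleton.1 (Multiset.mem_of_mem_nsmul h)).ge
    · obtain ⟨y, hy, rfl⟩ := Multiset.mem_map.1 h
      exact (inv_pos.2 (hs y hy)).le
  unfold outerCount
  rw [roots_mul (mul_ne_zero h1 hQ), Multiset.filter_add, h3, natDegree_mul h1 hQ,
    natDegree_mul (pow_ne_zero _ X_ne_zero) (invProd_ne_zero s), natDegree_X_pow,
    natDegree_invProd hs]
  simp
  omega

theorem prod_X_sub_C_eq_X_pow_mul (t : Multiset ℝ) (ht : ∀ a ∈ t, 0 ≤ a) :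
    ∃ (c : ℝ) (m : ℕ) (s : Multiset ℝ), c ≠ 0 ∧ (∀ y ∈ s, 0 < y) ∧
      (t.map fun a => X - C a).prod = X ^ m * invProd s * C c := by
  induction t using Multiset.induction_on with
  | empty => exact ⟨1, 0, 0, one_ne_zero, by simp, by simp [invProd_zero]⟩
  | cons a t ih =>
    obtain ⟨c, m, s, hc, hs, h⟩ := ih fun z hz => ht z (Multiset.mem_cons_of_mem hz)
    rcases (ht a (Multiset.mem_cons_self a t)).eq_or_lt with ha | ha
    · refine ⟨c, m + 1, s, hc, hs, ?_⟩
      rw [Multiset.map_cons, Multiset.prod_cons, h, ← ha]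
      simp
      ring
    · refine ⟨-a * c, m, a⁻¹ ::ₘ s, mul_ne_zero (neg_ne_zero.2 ha.ne') hc, ?_, ?_⟩
      · intro y hy
        rcases Multiset.mem_cons.1 hy with rfl | hy
        · exact inv_pos.2 ha
        · exact hs y hy
      · have : (X - C a : ℝ[X]) = C (-a) * (1 - C a⁻¹ * X) := by
          rw [mul_sub, ← mul_assoc, ← C_mul, neg_mul, mul_inv_cancel₀ ha.ne']
          simp
          ring
        rw [Multiset.map_cons, Multiset.prod_cons, h, invProd_cons, this, C_mul]
        ring

/-- The normal form behind every later estimate: zeros in `[0, ∞)` are split off, and the degree of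
the cofactor is exactly the outer count. Positive zeros are recorded by their reciprocals, since in
a limit zeros may escape to infinity, where the reciprocals tend to `0`. -/
theorem exists_eq_X_pow_mul_invProd_mul {p : ℝ[X]} (hp : p ≠ 0) :
    ∃ (m : ℕ) (s : Multiset ℝ) (Q : ℝ[X]), (∀ y ∈ s, 0 < y) ∧ p = X ^ m * invProd s * Q ∧
      Q.natDegree = outerCount p ∧ ∀ x : ℝ, 0 ≤ x → Q.eval x ≠ 0 := by
  set t := p.roots.filter (0 ≤ ·) with ht
  obtain ⟨Q, hQ⟩ := (Multiset.prod_X_sub_C_dvd_iff_le_roots hp t).2 (Multiset.filter_le _ _)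
  have hQ0 : Q ≠ 0 := by rintro rfl; simp at hQ; exact hp hQ
  obtain ⟨c, m, s, hc, hs, h⟩ := prod_X_sub_C_eq_X_pow_mul t fun a ha => by
    rw [ht, Multiset.mem_filter] at ha; exact ha.2
  have hne : (t.map fun a => (X - C a : ℝ[X])).prod ≠ 0 := (monic_multiset_prod_of_monic _ _
    fun a _ => monic_X_sub_C a).ne_zero
  refine ⟨m, s, C c * Q, hs, by rw [← mul_assoc, ← h, ← hQ], ?_, ?_⟩
  · rw [natDegree_C_mul hc, outerCount, ← ht]
    conv_rhs => rw [hQ, natDegree_mul hne hQ0, natDegree_multiset_prod_X_sub_C_eq_card]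
    omega
  · intro x hx h0
    have h1 : Q.IsRoot x := by simpa [hc] using h0
    have h2 : p.roots = t + Q.roots := by
      conv_lhs => rw [hQ, roots_mul (mul_ne_zero hne hQ0), roots_multiset_prod_X_sub_C]
    -- `t` already contains all nonnegative roots with multiplicity, so none is left for `Q`.
    have h3 : t = t + Q.roots.filter (0 ≤ ·) := by
      conv_lhs => rw [ht, h2, Multiset.filter_add]
      rw [Multiset.filter_eq_self.2]
      intro a ha
      rw [ht, Multiset.mem_filter] at ha; exact ha.2
    have h4 : Q.roots.filter (0 ≤ ·) = 0 := by simpa using h3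
    have h5 : x ∈ Q.roots.filter (0 ≤ ·) := Multiset.mem_filter.2 ⟨(mem_roots hQ0).2 h1, hx⟩
    simp [h4] at h5

theorem outerCount_mul_le_outerCount {s : Multiset ℝ} (hs : ∀ y ∈ s, 0 < y) (m : ℕ) {P : ℝ[X]}
    (hP : P ≠ 0) : outerCount (X ^ m * invProd s * P) ≤ outerCount P := by
  obtain ⟨m', s', Q, hs', h, hd, -⟩ := exists_eq_X_pow_mul_invProd_mul hP
  have hQ : Q ≠ 0 := by rintro rfl; simp at h; exact hP h
  have : X ^ m * invProd s * P = X ^ (m + m') * invProd (s + s') * Q := by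
    rw [h, invProd_add]; ring
  rw [this, ← hd]
  exact outerCount_mul_le (fun y hy => (Multiset.mem_add.1 hy).elim (hs y) (hs' y)) _ hQ

theorem outerCount_C_mul {c : ℝ} (hc : c ≠ 0) (p : ℝ[X]) :
    outerCount (C c * p) = outerCount p := by
  rw [outerCount, natDegree_C_mul hc, roots_C_mul _ hc, outerCount]

theorem reflect_invProd {s : Multiset ℝ} (hs : ∀ y ∈ s, 0 < y) :
    ∃ c : ℝ, c ≠ 0 ∧
      (invProd s).reflect (Multiset.card s) = C c * invProd (s.map (·⁻¹)) := by
  induction s using Multiset.induction_on with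
  | empty => exact ⟨1, one_ne_zero, by simp [invProd_zero]⟩
  | cons y s ih =>
    have hs' : ∀ y ∈ s, 0 < y := fun z hz => hs z (Multiset.mem_cons_of_mem hz)
    obtain ⟨c, hc, h⟩ := ih hs'
    have hy := hs y (Multiset.mem_cons_self y s)
    refine ⟨-y * c, mul_ne_zero (neg_ne_zero.2 hy.ne') hc, ?_⟩
    have hd : (1 - C y * X : ℝ[X]).natDegree ≤ 1 := by compute_degree
    rw [invProd_cons, Multiset.card_cons, add_comm, reflect_mul _ _ hd (natDegree_invProd hs').le,
      h, Multiset.map_cons, invProd_cons, reflect_sub, reflect_one, reflect_C_mul, reflect_one_X]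
    have : (X ^ 1 - C y * 1 : ℝ[X]) = C (-y) * (1 - C y⁻¹ * X) := by
      rw [mul_sub, ← mul_assoc, ← C_mul, neg_mul, mul_inv_cancel₀ hy.ne']
      simp
      ring
    rw [this, C_mul]
    ring

/-- The map `x ↦ 1/x` preserves `(0, ∞)`, and reversal exchanges zeros at `0` with missing degree.
Only the cofactor `Q` can contribute outer zeros, and its degree does not grow. -/
theorem outerCount_reflect_le {p : ℝ[X]} {n : ℕ} (hn : p.natDegree ≤ n) :
    outerCount (p.reflect n) ≤ outerCount p := by
  rcases eq_or_ne p 0 with rfl | hp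
  · simp
  obtain ⟨m, s, Q, hs, h, hd, -⟩ := exists_eq_X_pow_mul_invProd_mul hp
  have hQ : Q ≠ 0 := by rintro rfl; simp at h; exact hp h
  have h1 : (X ^ m * invProd s : ℝ[X]).natDegree = m + Multiset.card s := by
    rw [natDegree_mul (pow_ne_zero _ X_ne_zero) (invProd_ne_zero s), natDegree_X_pow,
      natDegree_invProd hs]
  have h2 : p.natDegree = m + Multiset.card s + Q.natDegree := by
    rw [h, natDegree_mul (mul_ne_zero (pow_ne_zero _ X_ne_zero) (invProd_ne_zero s)) hQ, h1]
  obtain ⟨e, rfl⟩ := Nat.exists_eq_add_of_le (h2 ▸ hn)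
  obtain ⟨c, hc, hr⟩ := reflect_invProd hs
  have h3 : p.reflect (m + Multiset.card s + Q.natDegree + e) =
      X ^ e * invProd (s.map (·⁻¹)) * (C c * Q.reflect Q.natDegree) := by
    have : p = X ^ m * invProd s * Q * 1 := by rw [mul_one, h]
    rw [this, reflect_mul _ _ ((natDegree_mul_le).trans (by rw [h1])) (by simp),
      reflect_mul _ _ h1.le le_rfl, reflect_mul _ _ (by simp) (natDegree_invProd hs).le, hr,
      reflect_one, reflect_monomial]
    simp
    ring
  rw [h3, ← hd]
  refine (outerCount_mul_le ?_ _ ?_).trans ?_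
  · intro y hy
    obtain ⟨a, ha, rfl⟩ := Multiset.mem_map.1 hy
    exact inv_pos.2 (hs a ha)
  · exact mul_ne_zero (C_ne_zero.2 hc) (by simpa using hQ)
  · rw [natDegree_C_mul hc]
    simpa using natDegree_reflect_le (N := Q.natDegree) (p := Q)

theorem invProd_comp (s : Multiset ℝ) (c : ℝ) :
    (invProd s).comp (C c * X) = invProd (s.map (· * c)) := by
  induction s using Multiset.induction_on with
  | empty => simp [invProd_zero]
  | cons y s ih =>
    rw [invProd_cons, mul_comp, ih, Multiset.map_cons, invProd_cons]
    simp
    left; ring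

theorem outerCount_comp_le {c : ℝ} (hc : 0 < c) (p : ℝ[X]) :
    outerCount (p.comp (C c * X)) ≤ outerCount p := by
  rcases eq_or_ne p 0 with rfl | hp
  · simp
  obtain ⟨m, s, Q, hs, h, hd, -⟩ := exists_eq_X_pow_mul_invProd_mul hp
  have hQ : Q ≠ 0 := by rintro rfl; simp at h; exact hp h
  have hdeg : (Q.comp (C c * X)).natDegree = Q.natDegree := by
    rw [natDegree_comp, natDegree_C_mul_X _ hc.ne', mul_one]
  have hQ' : Q.comp (C c * X) ≠ 0 := by
    intro h0
    rw [comp_eq_zero_iff] at h0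
    rcases h0 with h0 | ⟨-, h0⟩
    · exact hQ h0
    · have := congrArg (fun q => q.coeff 1) h0
      simp at this
      exact hc.ne' this
  have h3 : p.comp (C c * X) =
      X ^ m * invProd (s.map (· * c)) * (C (c ^ m) * Q.comp (C c * X)) := by
    conv_lhs => rw [h]
    rw [mul_comp, mul_comp, invProd_comp, X_pow_comp, mul_pow, C_pow]
    ring
  rw [h3, ← hd]
  refine (outerCount_mul_le ?_ _ ?_).trans ?_
  · intro y hy
    obtain ⟨a, ha, rfl⟩ := Multiset.mem_map.1 hy
    exact mul_pos (hs a ha) hc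
  · exact mul_ne_zero (C_ne_zero.2 (pow_ne_zero _ hc.ne')) hQ'
  · rw [natDegree_C_mul (pow_ne_zero _ hc.ne'), hdeg]

/-! ### Zero counts of entire functions with a polynomial factor -/

theorem evalC_eq_eval (P : ℝ[X]) (z : ℂ) : evalC P z = (P.map (algebraMap ℝ ℂ)).eval z := by
  rw [evalC, eval_map_algebraMap]

theorem evalC_mul (P Q : ℝ[X]) (z : ℂ) : evalC (P * Q) z = evalC P z * evalC Q z := by
  simp [evalC]

theorem evalC_eq_sum_range {P : ℝ[X]} {n : ℕ} (h : P.natDegree < n) (z : ℂ) :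
    evalC P z = ∑ k ∈ Finset.range n, ((P.coeff k : ℝ) : ℂ) * z ^ k := by
  rw [evalC_eq_eval, eval_eq_sum_range' (by rwa [natDegree_map])]
  simp

theorem evalC_ofReal (P : ℝ[X]) (x : ℝ) : evalC P x = ((P.eval x : ℝ) : ℂ) := by
  rw [evalC, ← Complex.coe_algebraMap, aeval_algebraMap_apply, coe_aeval_eq_eval]

theorem differentiable_evalC (P : ℝ[X]) : Differentiable ℂ (evalC P) := by
  have : evalC P = fun z => (P.map (algebraMap ℝ ℂ)).eval z := funext (evalC_eq_eval P)
  rw [this]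
  exact Polynomial.differentiable _

theorem evalC_ne_zero {P : ℝ[X]} (hP : P ≠ 0) : evalC P ≠ 0 := by
  intro h
  apply hP
  refine Polynomial.funext fun x => ?_
  have := congrFun h x
  rw [evalC_ofReal] at this
  simpa using this

theorem analyticOrderAt_evalC {Q : ℝ[X]} (hQ : Q ≠ 0) (z : ℂ) :
    analyticOrderAt (evalC Q) z = ((Q.map (algebraMap ℝ ℂ)).roots.count z : ℕ) := by
  have hQ' : Q.map (algebraMap ℝ ℂ) ≠ 0 := by rwa [Polynomial.map_ne_zero_iff
    (algebraMap ℝ ℂ).injective]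
  obtain ⟨q, hq, hd⟩ := exists_eq_pow_rootMultiplicity_mul_and_not_dvd _ hQ' z
  rw [count_roots, ((differentiable_evalC Q).analyticAt z).analyticOrderAt_eq_natCast]
  refine ⟨fun w => q.eval w, q.differentiable.analyticAt z, ?_, Eventually.of_forall fun w => ?_⟩
  · rwa [dvd_iff_isRoot] at hd
  · rw [evalC_eq_eval]
    conv_lhs => rw [hq]
    simp

theorem mem_S₀_iff {z : ℂ} : z ∈ S₀ ↔ ∃ x : ℝ, 0 ≤ x ∧ z = x := by
  constructor
  · rintro ⟨h1, h2⟩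
    exact ⟨z.re, h1, Complex.ext rfl (by simpa using h2)⟩
  · rintro ⟨x, hx, rfl⟩
    exact ⟨by simpa using hx, by simp⟩

theorem summable_enat {ι : Type*} (f : ι → ℕ∞) : Summable f :=
  ⟨_, hasSum_of_isLUB _ isLUB_iSup⟩

/-- Off `[0, ∞)` the factor `H` has order `0`, so orders of the product there are root
multiplicities of `Q`. -/
theorem zeroCount_mul_evalC_le {H : ℂ → ℂ} (hH : Differentiable ℂ H) (h0 : ∀ z ∈ S₀ᶜ, H z ≠ 0)
    {Q : ℝ[X]} (hQ : Q ≠ 0) : zeroCount (fun z => H z * evalC Q z) S₀ᶜ ≤ Q.natDegree := by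
  classical
  unfold zeroCount
  split_ifs
  · exact zero_le
  set R := (Q.map (algebraMap ℝ ℂ)).roots with hR
  have h1 : ∀ z : (S₀ᶜ : Set ℂ), analyticOrderAt (fun z => H z * evalC Q z) (z : ℂ) =
      (R.count (z : ℂ) : ℕ) := fun z => by
    have := analyticOrderAt_mul (hH.analyticAt z) ((differentiable_evalC Q).analyticAt z)
    rw [(hH.analyticAt (z : ℂ)).analyticOrderAt_eq_zero.2 (h0 z z.2), zero_add,
      analyticOrderAt_evalC hQ] at this
    exact this
  rw [tsum_congr h1, tsum_eq_sum (s := R.toFinset.subtype (· ∈ S₀ᶜ)) fun z hz => by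
    simpa using hz]
  rw [← Nat.cast_sum, Nat.cast_le]
  calc _ = ∑ z ∈ R.toFinset with z ∈ S₀ᶜ, R.count z :=
        Finset.sum_subtype_eq_sum_filter (fun z : ℂ => R.count z)
    _ ≤ ∑ z ∈ R.toFinset, R.count z := Finset.sum_le_sum_of_subset (Finset.filter_subset _ _)
    _ = Multiset.card R := Multiset.toFinset_sum_count_eq R
    _ ≤ _ := (card_roots' _).trans (natDegree_map_le)

/-- All `deg Q` complex roots of `Q` lie outside `[0, ∞)`, and `H` can only raise orders. The
product must be nonzero because of the convention `N(0; X) = 0`. -/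
theorem le_zeroCount_mul_evalC {H : ℂ → ℂ} (hH : Differentiable ℂ H) {Q : ℝ[X]}
    (hQ : ∀ x : ℝ, 0 ≤ x → Q.eval x ≠ 0) (hne : (fun z => H z * evalC Q z) ≠ 0) :
    Q.natDegree ≤ zeroCount (fun z => H z * evalC Q z) S₀ᶜ := by
  classical
  have hQ0 : Q ≠ 0 := by rintro rfl; exact hQ 0 le_rfl (by simp)
  rw [zeroCount, if_neg hne]
  set R := (Q.map (algebraMap ℝ ℂ)).roots with hR
  have h1 : ∀ z : (S₀ᶜ : Set ℂ), ((R.count (z : ℂ) : ℕ) : ℕ∞) ≤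
      analyticOrderAt (fun z => H z * evalC Q z) (z : ℂ) := fun z => by
    have := analyticOrderAt_mul (hH.analyticAt z) ((differentiable_evalC Q).analyticAt z)
    rw [analyticOrderAt_evalC hQ0] at this
    exact le_of_le_of_eq (self_le_add_left _ _) this.symm
  refine le_trans ?_ ((summable_enat _).sum_le_tsum (R.toFinset.subtype (· ∈ S₀ᶜ))
    fun _ _ => zero_le)
  refine le_trans ?_ (Finset.sum_le_sum fun z _ => h1 z)
  rw [← Nat.cast_sum, Nat.cast_le]
  refine Eq.le ?_
  calc Q.natDegree = Multiset.card R := by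
        rw [hR, ← (IsAlgClosed.splits _).natDegree_eq_card_roots, natDegree_map]
    _ = ∑ z ∈ R.toFinset, R.count z := (Multiset.toFinset_sum_count_eq R).symm
    _ = ∑ z ∈ R.toFinset with z ∈ S₀ᶜ, R.count z := by
        rw [Finset.filter_true_of_mem]
        intro z hz hz'
        obtain ⟨x, hx, rfl⟩ := mem_S₀_iff.1 hz'
        rw [Multiset.mem_toFinset, hR, mem_roots', IsRoot, ← evalC_eq_eval, evalC_ofReal] at hz
        exact hQ x hx (by exact_mod_cast hz.2)
    _ = _ := (Finset.sum_subtype_eq_sum_filter (fun z : ℂ => R.count z)).symm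

theorem evalC_X_pow_mul_invProd_ne_zero {s : Multiset ℝ} (hs : ∀ y ∈ s, 0 < y) (m : ℕ) {z : ℂ}
    (hz : z ∈ S₀ᶜ) : evalC (X ^ m * invProd s) z ≠ 0 := by
  rw [evalC_mul]
  refine mul_ne_zero ?_ ?_
  · simp only [evalC, map_pow, aeval_X]
    refine pow_ne_zero _ fun h => hz ?_
    simp [h, S₀]
  · induction s using Multiset.induction_on with
    | empty => simp [invProd_zero, evalC]
    | cons y s ih =>
      rw [invProd_cons, evalC_mul]
      refine mul_ne_zero (fun h => hz ?_) (ih fun z hz => hs z (Multiset.mem_cons_of_mem hz))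
      have hy := hs y (Multiset.mem_cons_self y s)
      rw [mem_S₀_iff]
      refine ⟨y⁻¹, (inv_pos.2 hy).le, ?_⟩
      simp only [evalC, map_sub, map_one, map_mul, aeval_C, aeval_X, Complex.coe_algebraMap] at h
      have hy' : (y : ℂ) ≠ 0 := by exact_mod_cast hy.ne'
      push_cast
      field_simp
      linear_combination -h

theorem outerCount_le_zeroCount_mul {g : ℂ → ℂ} (hg : Differentiable ℂ g) {P : ℝ[X]}
    (hne : (fun z => evalC P z * g z) ≠ 0) :
    outerCount P ≤ zeroCount (fun z => evalC P z * g z) S₀ᶜ := by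
  have hP : P ≠ 0 := by
    rintro rfl
    exact hne (funext fun z => by simp [evalC])
  obtain ⟨m, s, Q, hs, h, hd, hr⟩ := exists_eq_X_pow_mul_invProd_mul hP
  have h1 : (fun z => evalC P z * g z) =
      fun z => (evalC (X ^ m * invProd s) z * g z) * evalC Q z := by
    funext z; rw [h, evalC_mul]; ring
  rw [h1] at hne ⊢
  rw [← hd]
  exact le_zeroCount_mul_evalC ((differentiable_evalC _).mul hg) hr hne

theorem zeroCount_evalC (P : ℝ[X]) : zeroCount (evalC P) S₀ᶜ = outerCount P := by
  rcases eq_or_ne P 0 with rfl | hP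
  · have : evalC 0 = 0 := funext fun z => by simp [evalC]
    simp [this, zeroCount, outerCount]
  refine le_antisymm ?_ ?_
  · obtain ⟨m, s, Q, hs, h, hd, hr⟩ := exists_eq_X_pow_mul_invProd_mul hP
    have h1 : evalC P = fun z => evalC (X ^ m * invProd s) z * evalC Q z := by
      funext z; rw [h, evalC_mul]
    rw [h1, ← hd]
    refine zeroCount_mul_evalC_le (differentiable_evalC _)
      (fun z hz => evalC_X_pow_mul_invProd_ne_zero hs m hz) ?_
    rintro rfl
    simp at h
    exact hP h
  · have := outerCount_le_zeroCount_mul (g := fun _ => 1) (differentiable_const _) (P := P)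
      (by simpa using evalC_ne_zero hP)
    simpa using this

/-! ### Appell polynomials -/

theorem derivative_appell (f : PowerSeries ℝ) (n : ℕ) :
    derivative (appell f (n + 1)) = C ((n : ℝ) + 1) * appell f n := by
  rw [appell, appell, Finset.sum_range_succ, derivative_add, derivative_sum, Finset.mul_sum]
  simp only [Nat.sub_self, derivative_monomial, Nat.cast_zero, mul_zero, monomial_zero_right,
    add_zero]
  refine Finset.sum_congr rfl fun k hk => ?_
  have hk' : k ≤ n := Nat.lt_succ_iff.1 (Finset.mem_range.1 hk)
  obtain ⟨d, rfl⟩ := Nat.exists_eq_add_of_le hk'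
  rw [C_mul_monomial]
  have h1 : k + d + 1 - k = d + 1 := by omega
  have h2 : k + d - k = d := by omega
  rw [h1, h2, Nat.add_sub_cancel]
  congr 1
  rw [Nat.factorial_succ, Nat.factorial_succ]
  have := Nat.factorial_ne_zero d
  push_cast
  field_simp

theorem appellCount_eq (f : PowerSeries ℝ) (n : ℕ) :
    appellCount f n = outerCount (appell f n) := zeroCount_evalC _

theorem appellCount_zero (f : PowerSeries ℝ) : appellCount f 0 = 0 := by
  have : outerCount (appell f 0) ≤ (appell f 0).natDegree := Nat.sub_le _ _
  rw [appellCount_eq]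
  simp only [appell, zero_add, Finset.range_one, Finset.sum_singleton, Nat.sub_zero,
    monomial_zero_left, natDegree_C] at this ⊢
  exact_mod_cast Nat.le_zero.1 this

theorem appellCount_le_succ (f : PowerSeries ℝ) (n : ℕ) :
    appellCount f n ≤ appellCount f (n + 1) := by
  rw [appellCount_eq, appellCount_eq, Nat.cast_le]
  have := outerCount_derivative_le (appell f (n + 1))
  rwa [derivative_appell, outerCount_C_mul (by positivity)] at this

/-! ### Coefficient and root bounds for `∏ (1 - w X)` -/

theorem pow_succ_add_mul_le {a b : ℝ} (ha : 0 ≤ a) (hb : 0 ≤ b) (k : ℕ) :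
    a ^ (k + 1) + (k + 1) * b * a ^ k ≤ (b + a) ^ (k + 1) := by
  induction k with
  | zero => simp; linarith
  | succ k ih =>
    have h1 : 0 ≤ (k + 1) * b ^ 2 * a ^ k := by positivity
    have h2 := mul_le_mul_of_nonneg_left ih (add_nonneg hb ha)
    calc a ^ (k + 1 + 1) + ((k + 1 : ℕ) + 1) * b * a ^ (k + 1)
        ≤ (b + a) * (a ^ (k + 1) + (k + 1) * b * a ^ k) := by
          push_cast
          linarith [show (b + a) * (a ^ (k + 1) + (k + 1) * b * a ^ k) =
            a ^ (k + 1 + 1) + ((k + 1 : ℝ) + 1) * b * a ^ (k + 1) + (k + 1) * b ^ 2 * a ^ k by ring]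
      _ ≤ _ := by rw [pow_succ' (b + a) (k + 1)]; exact h2

/-- The elementary symmetric estimate `|e_k| ≤ (∑ |w|)^k / k!`. The induction adds one factor at a
time and needs only the first two terms of the binomial expansion. -/
theorem norm_coeff_invProd_le {𝕜 : Type*} [NormedField 𝕜] (W : Multiset 𝕜) (k : ℕ) :
    ‖(invProd W).coeff k‖ ≤ (W.map norm).sum ^ k / (k.factorial : ℝ) := by
  induction W using Multiset.induction_on generalizing k with
  | empty =>
    rcases k with _ | k
    · simp [invProd_zero]
    · simp [invProd_zero, coeff_one]
  | cons w W ih =>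
    have hS : 0 ≤ (W.map norm).sum := Multiset.sum_nonneg fun x hx => by
      obtain ⟨a, -, rfl⟩ := Multiset.mem_map.1 hx
      exact norm_nonneg a
    rcases k with _ | k
    · simp [coeff_zero_invProd]
    · have h1 : (invProd (w ::ₘ W)).coeff (k + 1) =
          (invProd W).coeff (k + 1) - w * (invProd W).coeff k := by
        rw [invProd_cons, sub_mul, one_mul, mul_assoc, coeff_sub, coeff_C_mul, coeff_X_mul]
      rw [h1, Multiset.map_cons, Multiset.sum_cons]
      calc _ ≤ ‖(invProd W).coeff (k + 1)‖ + ‖w‖ * ‖(invProd W).coeff k‖ :=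
            (norm_sub_le _ _).trans (by rw [norm_mul])
        _ ≤ (W.map norm).sum ^ (k + 1) / ((k + 1).factorial : ℝ) +
              ‖w‖ * ((W.map norm).sum ^ k / (k.factorial : ℝ)) := by
            gcongr
            · exact ih _
            · exact ih _
        _ = ((W.map norm).sum ^ (k + 1) + (k + 1) * ‖w‖ * (W.map norm).sum ^ k) /
              ((k + 1).factorial : ℝ) := by
            rw [Nat.factorial_succ]
            have := Nat.factorial_ne_zero k
            push_cast
            field_simp
        _ ≤ _ := by
            gcongr
            exact pow_succ_add_mul_le hS (norm_nonneg w) k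

theorem coeff_one_invProd {R : Type*} [CommRing R] (W : Multiset R) :
    (invProd W).coeff 1 = -W.sum := by
  induction W using Multiset.induction_on with
  | empty => simp [invProd_zero, coeff_one]
  | cons w W ih =>
    rw [invProd_cons, sub_mul, one_mul, mul_assoc, coeff_sub, coeff_C_mul, coeff_X_mul,
      coeff_zero_invProd, ih, Multiset.sum_cons]
    ring

theorem sum_norm_le_card_mul {U : Multiset ℂ} {t : ℝ} (h : ∀ w ∈ U, ‖w‖ ≤ t) :
    (U.map norm).sum ≤ Multiset.card U * t := by
  have := Multiset.sum_le_card_nsmul (U.map norm) t fun x hx => by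
    obtain ⟨a, ha, rfl⟩ := Multiset.mem_map.1 hx
    exact h a ha
  simpa using this

theorem sum_map_norm_ofReal {s : Multiset ℝ} (hs : ∀ y ∈ s, 0 < y) :
    ((s.map Complex.ofReal).map norm).sum = s.sum := by
  rw [Multiset.map_map]
  congr 1
  conv_rhs => rw [← Multiset.map_id s]
  exact Multiset.map_congr rfl fun y hy => by simp [abs_of_pos (hs y hy)]

theorem sum_map_norm_nonneg (U : Multiset ℂ) : 0 ≤ (U.map norm).sum :=
  Multiset.sum_nonneg fun x hx => by
    obtain ⟨a, -, rfl⟩ := Multiset.mem_map.1 hx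
    exact norm_nonneg a

/-- Positive numbers cannot cancel, so their sum is recovered from the linear coefficient with an
error of at most `∑_U |w|`. Adding the norms over `U` themselves produces the factor `2`. -/
theorem sum_norm_le {s : Multiset ℝ} (hs : ∀ y ∈ s, 0 < y) {U : Multiset ℂ} {t : ℝ}
    (h : ∀ w ∈ U, ‖w‖ ≤ t) :
    ((s.map Complex.ofReal + U).map norm).sum ≤
      ‖(invProd (s.map Complex.ofReal + U)).coeff 1‖ + 2 * (Multiset.card U * t) := by
  have h1 := sum_norm_le_card_mul h
  have h3 : ((s.sum : ℝ) : ℂ) = -(invProd (s.map Complex.ofReal + U)).coeff 1 - U.sum := by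
    rw [coeff_one_invProd, Multiset.sum_add]
    have := map_multiset_sum Complex.ofRealHom s
    simp only [Complex.ofRealHom_eq_coe] at this
    rw [this]
    ring
  have h5 : s.sum ≤ ‖(invProd (s.map Complex.ofReal + U)).coeff 1‖ + (U.map norm).sum := by
    calc s.sum ≤ ‖((s.sum : ℝ) : ℂ)‖ := by
          rw [Complex.norm_real]; exact le_abs_self _
      _ ≤ ‖(invProd (s.map Complex.ofReal + U)).coeff 1‖ + ‖U.sum‖ := by
          rw [h3]
          exact (norm_sub_le _ _).trans (by rw [norm_neg])
      _ ≤ _ := by gcongr; exact norm_multiset_sum_le U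
  rw [Multiset.map_add, Multiset.sum_add, sum_map_norm_ofReal hs]
  linarith

theorem eval_inv_invProd {W : Multiset ℂ} {w : ℂ} (hw : w ∈ W) (h0 : w ≠ 0) :
    (invProd W).eval w⁻¹ = 0 := by
  obtain ⟨W, rfl⟩ := Multiset.exists_cons_of_mem hw
  simp [invProd_cons, mul_inv_cancel₀ h0]

/-- Scale so that the largest `|w|`, say `t`, becomes `1`. The scaled coefficients are at most `D^k
/ k!` with `D` depending only on `M₁` and `B`, so the tail beyond a fixed `K` is small. If `t` were
large, the first `K` nonconstant coefficients would be small too, although together they must cancel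
the constant term `1` at a root of modulus `1`. -/
theorem exists_root_bound (B : ℕ) {M₁ : ℝ} (hM₁ : 0 ≤ M₁) :
    ∃ K : ℕ, ∀ (s : Multiset ℝ) (U : Multiset ℂ) (M : ℝ), 0 ≤ M → (∀ y ∈ s, 0 < y) →
      Multiset.card U ≤ B → ‖(invProd (s.map Complex.ofReal + U)).coeff 1‖ ≤ M₁ →
      (∀ k ≤ K, ‖(invProd (s.map Complex.ofReal + U)).coeff k‖ ≤ M) →
      ∀ w ∈ s.map Complex.ofReal + U, ‖w‖ ≤ 2 * K * M + 1 := by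
  set D : ℝ := M₁ + 2 * B with hD
  have hD0 : 0 ≤ D := by positivity
  set u : ℕ → ℝ := fun k => D ^ (k + 1) / ((k + 1).factorial : ℝ) with hu
  have hsum : Summable u := (summable_nat_add_iff 1).2 (Real.summable_pow_div_factorial D)
  -- `K` makes the tail of the majorant less than `1/2`. The bound `2KM + 1` makes the first `K`
  -- terms contribute at most `1/2`, and its `+ 1` ensures `t > 1`.
  obtain ⟨K, hK⟩ := ((tendsto_order.1 (tendsto_sum_nat_add u)).2 (1 / 2) (by norm_num)).exists
  refine ⟨K, fun s U M hM hs hU hc1 hck w hw => ?_⟩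
  by_contra! hlt
  set W := s.map Complex.ofReal + U with hW
  classical
  obtain ⟨w₀, hw₀, hmax⟩ := W.toFinset.exists_max_image norm ⟨w, by simpa using hw⟩
  rw [Multiset.mem_toFinset] at hw₀
  have hmax' : ∀ v ∈ W, ‖v‖ ≤ ‖w₀‖ := fun v hv => hmax v (by simpa using hv)
  set t := ‖w₀‖ with ht
  have ht1 : 2 * K * M + 1 < t := hlt.trans_le (hmax' w hw)
  have hKM : 0 ≤ 2 * (K : ℝ) * M := by positivity
  have ht0 : 0 < t := by linarith
  have hS : (W.map norm).sum ≤ D * t := by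
    have h1 := sum_norm_le hs (U := U) (t := t) fun v hv => hmax' v (Multiset.mem_add.2 (Or.inr hv))
    have h2 : (Multiset.card U : ℝ) ≤ B := by exact_mod_cast hU
    rw [← hW] at h1
    have h3 : M₁ ≤ M₁ * t := le_mul_of_one_le_right hM₁ (by linarith)
    have h4 : (Multiset.card U : ℝ) * t ≤ B * t := by gcongr
    rw [hD]
    linarith
  have hS0 : 0 ≤ (W.map norm).sum := sum_map_norm_nonneg W
  set p := invProd W with hp
  set a : ℕ → ℝ := fun k => ‖p.coeff (k + 1)‖ / t ^ (k + 1) with ha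
  have ha0 : ∀ k, 0 ≤ a k := fun k => by positivity
  have ha1 : ∀ k, a k ≤ u k := fun k => by
    rw [ha, hu]
    simp only
    rw [div_le_iff₀ (by positivity)]
    calc ‖p.coeff (k + 1)‖ ≤ (W.map norm).sum ^ (k + 1) / ((k + 1).factorial : ℝ) :=
          norm_coeff_invProd_le W _
      _ ≤ (D * t) ^ (k + 1) / ((k + 1).factorial : ℝ) := by gcongr
      _ = _ := by rw [mul_pow]; ring
  have ha2 : ∀ k < K, a k ≤ M / t := fun k hk => by
    have h1 : 1 ≤ t ^ k := one_le_pow₀ (by linarith)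
    calc a k ≤ M / t ^ (k + 1) := by
          rw [ha]
          simp only
          gcongr
          exact hck (k + 1) hk
      _ ≤ M / t := by
          gcongr
          rw [pow_succ]
          exact le_mul_of_one_le_left ht0.le h1
  have hz : (1 : ℝ) ≤ ∑ k ∈ Finset.range (K + p.natDegree), a k := by
    have h0 : p.eval w₀⁻¹ = 0 := eval_inv_invProd hw₀ (norm_pos_iff.1 ht0)
    rw [eval_eq_sum_range' (n := K + p.natDegree + 1) (by omega), Finset.sum_range_succ',
      coeff_zero_invProd, pow_zero, mul_one] at h0
    have h1 := eq_neg_of_add_eq_zero_left h0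
    have h2 : ‖∑ k ∈ Finset.range (K + p.natDegree), p.coeff (k + 1) * w₀⁻¹ ^ (k + 1)‖ = 1 := by
      rw [h1, norm_neg, norm_one]
    rw [← h2]
    refine (norm_sum_le _ _).trans (Finset.sum_le_sum fun k _ => ?_)
    rw [norm_mul, norm_pow, norm_inv, inv_pow, ← div_eq_mul_inv]
  rw [Finset.sum_range_add] at hz
  have h1 : ∑ k ∈ Finset.range K, a k ≤ K * (M / t) := by
    have := Finset.sum_le_card_nsmul (Finset.range K) a (M / t) fun k hk =>
      ha2 k (Finset.mem_range.1 hk)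
    simpa using this
  have h2 : ∑ k ∈ Finset.range p.natDegree, a (K + k) ≤ ∑' k, u (k + K) := by
    refine (Finset.sum_le_sum fun k _ => (ha1 (K + k)).trans_eq (by rw [add_comm])).trans
      (((summable_nat_add_iff K).2 hsum).sum_le_tsum _ fun k _ => (ha0 (k + K)).trans (ha1 _))
  have h3 : K * (M / t) ≤ 1 / 2 := by
    rw [← mul_div_assoc, div_le_iff₀ ht0]
    linarith
  linarith

theorem exists_eq_invProd {q : ℂ[X]} (h : q.coeff 0 = 1) :
    ∃ U : Multiset ℂ, Multiset.card U = q.natDegree ∧ q = invProd U := by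
  have hroot : ∀ a ∈ q.roots, a ≠ 0 := by
    rintro a ha rfl
    have := (mem_roots'.1 ha).2
    rw [IsRoot, ← coeff_zero_eq_eval_zero, h] at this
    exact one_ne_zero this
  have key : ∀ t : Multiset ℂ, (∀ a ∈ t, a ≠ 0) →
      ∃ c : ℂ, (t.map fun a => X - C a).prod = C c * invProd (t.map (·⁻¹)) := by
    intro t ht
    induction t using Multiset.induction_on with
    | empty => exact ⟨1, by simp [invProd_zero]⟩
    | cons a t ih =>
      obtain ⟨c, hc⟩ := ih fun z hz => ht z (Multiset.mem_cons_of_mem hz)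
      have ha := ht a (Multiset.mem_cons_self a t)
      refine ⟨-a * c, ?_⟩
      have : (X - C a : ℂ[X]) = C (-a) * (1 - C a⁻¹ * X) := by
        rw [mul_sub, ← mul_assoc, ← C_mul, neg_mul, mul_inv_cancel₀ ha]
        simp
        ring
      rw [Multiset.map_cons, Multiset.prod_cons, hc, Multiset.map_cons, invProd_cons, this, C_mul]
      ring
  obtain ⟨c, hc⟩ := key q.roots hroot
  have hs := (IsAlgClosed.splits q).eq_prod_roots
  refine ⟨q.roots.map (·⁻¹), ?_, ?_⟩
  · rw [Multiset.card_map, (IsAlgClosed.splits q).natDegree_eq_card_roots]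
  · rw [hc, ← mul_assoc, ← C_mul] at hs
    have h1 : q.leadingCoeff * c = 1 := by
      rw [← h]
      conv_rhs => rw [hs]
      rw [coeff_C_mul, coeff_zero_invProd, mul_one]
    rw [h1, C_1, one_mul] at hs
    exact hs

/-! ### Limits of polynomials with dominated coefficients -/

/-- Working along an ultrafilter replaces diagonal extraction of subsequences: all bounded real
quantities converge simultaneously. -/
theorem exists_tendsto_of_eventually_le {ι : Type*} (l : Ultrafilter ι) (x : ι → ℝ) (D : ℝ)
    (h : ∀ᶠ i in (l : Filter ι), |x i| ≤ D) : ∃ a, Tendsto x l (𝓝 a) := by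
  obtain ⟨a, -, ha⟩ := (isCompact_Icc (a := -D) (b := D)).ultrafilter_le_nhds (l.map x) (by
    rw [le_principal_iff]
    exact h.mono fun i hi => abs_le.1 hi)
  exact ⟨a, ha⟩

theorem exists_tendsto_evalC {ι : Type*} {l : Filter ι} [l.NeBot] {p : ι → ℝ[X]} {b u : ℕ → ℝ}
    (hu : ∀ r : ℝ, 0 ≤ r → Summable fun k => u k * r ^ k)
    (hp : ∀ᶠ i in l, ∀ k, |(p i).coeff k| ≤ u k)
    (hb : ∀ k, Tendsto (fun i => (p i).coeff k) l (𝓝 (b k))) :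
    ∃ F : ℂ → ℂ, (∀ z, HasSum (fun k : ℕ => ((b k : ℝ) : ℂ) * z ^ k) (F z)) ∧
      ∀ z, Tendsto (fun i => evalC (p i) z) l (𝓝 (F z)) := by
  have hbu : ∀ k, |b k| ≤ u k := fun k =>
    le_of_tendsto (hb k).abs (hp.mono fun i hi => hi k)
  have hs : ∀ z : ℂ, Summable fun k : ℕ => ((b k : ℝ) : ℂ) * z ^ k := fun z => by
    refine Summable.of_norm_bounded (hu ‖z‖ (norm_nonneg z)) fun k => ?_
    rw [norm_mul, norm_pow, Complex.norm_real, Real.norm_eq_abs]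
    gcongr
    exact hbu k
  refine ⟨fun z => ∑' k : ℕ, ((b k : ℝ) : ℂ) * z ^ k, fun z => (hs z).hasSum, fun z => ?_⟩
  have h1 : ∀ i, evalC (p i) z = ∑' k : ℕ, (((p i).coeff k : ℝ) : ℂ) * z ^ k := fun i => by
    rw [evalC_eq_sum_range (Nat.lt_succ_self _), tsum_eq_sum]
    intro k hk
    rw [coeff_eq_zero_of_natDegree_lt (by simpa using hk)]
    simp
  simp_rw [h1]
  refine tendsto_tsum_of_dominated_convergence (hu ‖z‖ (norm_nonneg z)) (fun k => ?_) ?_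
  · exact ((Complex.continuous_ofReal.tendsto _).comp (hb k)).mul_const _
  · refine hp.mono fun i hi k => ?_
    rw [norm_mul, norm_pow, Complex.norm_real, Real.norm_eq_abs]
    gcongr
    exact hi k

theorem hasFPowerSeriesOnBall_of_hasSum {c : ℕ → ℂ} {F : ℂ → ℂ}
    (h : ∀ z, HasSum (fun k : ℕ => c k * z ^ k) (F z)) :
    HasFPowerSeriesOnBall F (FormalMultilinearSeries.ofScalars ℂ c) 0 ⊤ where
  r_le := by
    refine ENNReal.le_of_forall_nnreal_lt fun r _ => ?_
    refine FormalMultilinearSeries.le_radius_of_summable _ ?_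
    refine ((h r).summable.norm).congr fun k => ?_
    rw [FormalMultilinearSeries.ofScalars_norm]
    simp
  r_pos := by simp
  hasSum := fun {z} _ => by
    rw [zero_add]
    simpa [FormalMultilinearSeries.ofScalars_apply_eq, mul_comm] using h z

theorem differentiable_of_hasSum {c : ℕ → ℂ} {F : ℂ → ℂ}
    (h : ∀ z, HasSum (fun k : ℕ => c k * z ^ k) (F z)) : Differentiable ℂ F := by
  have := (hasFPowerSeriesOnBall_of_hasSum h).differentiableOn
  simpa [differentiableOn_univ] using this

theorem coeff_unique_of_hasSum {c d : ℕ → ℂ} {F : ℂ → ℂ}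
    (hc : ∀ z, HasSum (fun k : ℕ => c k * z ^ k) (F z))
    (hd : ∀ z, HasSum (fun k : ℕ => d k * z ^ k) (F z)) : c = d := by
  have := (hasFPowerSeriesOnBall_of_hasSum hc).hasFPowerSeriesAt.eq_formalMultilinearSeries
    (hasFPowerSeriesOnBall_of_hasSum hd).hasFPowerSeriesAt
  exact FormalMultilinearSeries.ofScalars_series_injective (𝕜 := ℂ) ℂ this

/-! ### Limits of products `∏ (1 - y X)` with positive `y` of bounded sum -/

theorem sum_range_getD {M : Type*} [AddCommMonoid M] (l : List ℝ) (φ : ℝ → M) :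
    ∑ j ∈ Finset.range l.length, φ (l.getD j 0) = (l.map φ).sum := by
  induction l with
  | nil => simp
  | cons a l ih =>
    rw [List.length_cons, Finset.sum_range_succ', List.map_cons, List.sum_cons, ← ih, add_comm]
    simp

theorem prod_range_getD {M : Type*} [CommMonoid M] (l : List ℝ) (φ : ℝ → M) :
    ∏ j ∈ Finset.range l.length, φ (l.getD j 0) = (l.map φ).prod :=
  sum_range_getD (M := Additive M) l φ

/-- In decreasing order the first `j + 1` terms are each at least `y j`, hence `(j + 1) y j ≤ ∑ y`.
This gives a square-summable majorant uniform in the multiset. -/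
theorem exists_antitone_enumeration {s : Multiset ℝ} (hs : ∀ y ∈ s, 0 < y) :
    ∃ (L : ℕ) (y : ℕ → ℝ), (∀ j, 0 ≤ y j) ∧ (∀ j, L ≤ j → y j = 0) ∧
      (∀ j, (j + 1) * y j ≤ s.sum) ∧ ∑ j ∈ Finset.range L, y j = s.sum ∧
      ∀ z : ℂ, ∏ j ∈ Finset.range L, (1 - z * y j) = evalC (invProd s) z := by
  set l := s.sort (· ≥ ·) with hl
  have hls : (l : Multiset ℝ) = s := Multiset.sort_eq s _
  have hzero : ∀ j, l.length ≤ j → l.getD j 0 = 0 := fun j hj =>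
    List.getD_eq_default _ _ hj
  have hnn : ∀ j, 0 ≤ l.getD j 0 := fun j => by
    rcases lt_or_ge j l.length with h | h
    · rw [List.getD_eq_getElem _ _ h]
      refine (hs _ ?_).le
      rw [← hls, Multiset.mem_coe]
      exact List.getElem_mem h
    · rw [hzero j h]
  have hanti : ∀ i j, i ≤ j → l.getD j 0 ≤ l.getD i 0 := fun i j hij => by
    rcases lt_or_ge j l.length with h | h
    · rw [List.getD_eq_getElem _ _ h, List.getD_eq_getElem _ _ (hij.trans_lt h)]
      rcases hij.eq_or_lt with rfl | hij'
      · exact le_rfl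
      · exact List.pairwise_iff_getElem.1 (Multiset.pairwise_sort s (· ≥ ·)) i j _ h hij'
    · rw [hzero j h]; exact hnn i
  have hsum : ∑ j ∈ Finset.range l.length, l.getD j 0 = s.sum := by
    rw [sum_range_getD l fun x => x, List.map_id', ← Multiset.sum_coe, hls]
  refine ⟨l.length, fun j => l.getD j 0, hnn, hzero, fun j => ?_, hsum, fun z => ?_⟩
  · rcases lt_or_ge j l.length with h | h
    · rw [← hsum]
      calc ((j : ℝ) + 1) * l.getD j 0 = ∑ i ∈ Finset.range (j + 1), l.getD j 0 := by simp
        _ ≤ ∑ i ∈ Finset.range (j + 1), l.getD i 0 := Finset.sum_le_sum fun i hi =>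
            hanti i j (Nat.lt_succ_iff.1 (Finset.mem_range.1 hi))
        _ ≤ _ := Finset.sum_le_sum_of_subset_of_nonneg
            (Finset.range_subset_range.2 h) fun i _ _ => hnn i
    · change (_ + 1) * l.getD j 0 ≤ _
      rw [hzero j h, mul_zero]
      exact Multiset.sum_nonneg fun y hy => (hs y hy).le
  · rw [prod_range_getD l fun x => 1 - z * (x : ℂ), ← Multiset.prod_coe, ← Multiset.map_coe, hls,
      evalC, invProd, map_multiset_prod, Multiset.map_map]
    congr 1
    refine Multiset.map_congr rfl fun y _ => ?_
    simp only [Function.comp_apply, map_sub, map_one, map_mul, aeval_C, aeval_X,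
      Complex.coe_algebraMap]
    rw [mul_comm]

theorem norm_one_sub_mul_exp_sub_one_le (w : ℂ) :
    ‖(1 - w) * Complex.exp w - 1‖ ≤ 2 * ‖w‖ ^ 2 * Real.exp ‖w‖ := by
  have h1 := Complex.norm_exp_sub_sum_le_norm_mul_exp w 1
  have h2 := Complex.norm_exp_sub_sum_le_norm_mul_exp w 2
  simp [Finset.sum_range_succ] at h1 h2
  have h3 : (1 - w) * Complex.exp w - 1 =
      (Complex.exp w - (1 + w)) - w * (Complex.exp w - 1) := by ring
  rw [h3]
  calc _ ≤ ‖Complex.exp w - (1 + w)‖ + ‖w‖ * ‖Complex.exp w - 1‖ :=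
        (norm_sub_le _ _).trans (by rw [norm_mul])
    _ ≤ ‖w‖ ^ 2 * Real.exp ‖w‖ + ‖w‖ * (‖w‖ * Real.exp ‖w‖) := by gcongr
    _ = _ := by ring

theorem summable_div_succ_sq (D : ℝ) : Summable fun j : ℕ => (D / ((j : ℝ) + 1)) ^ 2 := by
  have h := (summable_nat_add_iff 1).2 (Real.summable_one_div_nat_pow.2 one_lt_two)
  refine (h.mul_left (D ^ 2)).congr fun j => ?_
  push_cast
  rw [div_pow]
  ring

/-- The bound `S / (j + 1)` is not summable, but the convergence factor makes each term differ from
`1` by `O(y²)`, so dominated convergence for products applies. -/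
theorem tendsto_tprod_mul_exp {ι : Type*} {l : Filter ι} {y : ι → ℕ → ℝ} {Y : ℕ → ℝ} {S : ℝ}
    (hy0 : ∀ i j, 0 ≤ y i j) (hyS : ∀ᶠ i in l, ∀ j : ℕ, (j + 1) * y i j ≤ S)
    (hY : ∀ j, Tendsto (fun i => y i j) l (𝓝 (Y j))) (z : ℂ) :
    Tendsto (fun i => ∏' j, (1 - z * y i j) * Complex.exp (z * y i j)) l
      (𝓝 (∏' j, (1 - z * Y j) * Complex.exp (z * Y j))) := by
  have h := tendsto_tprod_one_add_of_dominated_convergence (𝓕 := l)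
    (f := fun i j => (1 - z * y i j) * Complex.exp (z * y i j) - 1)
    (g := fun j => (1 - z * Y j) * Complex.exp (z * Y j) - 1)
    (bound := fun j : ℕ => (‖z‖ * S / ((j : ℝ) + 1)) ^ 2 * (2 * Real.exp (‖z‖ * S)))
    ((summable_div_succ_sq _).mul_right _) (fun j => ?_) ?_
  · simpa using h
  · have h1 : Tendsto (fun i => z * (y i j : ℂ)) l (𝓝 (z * Y j)) :=
      ((Complex.continuous_ofReal.tendsto _).comp (hY j)).const_mul z
    exact ((h1.const_sub 1).mul h1.cexp).sub_const 1
  · filter_upwards [hyS] with i hi j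
    refine (norm_one_sub_mul_exp_sub_one_le _).trans ?_
    have hj : (0 : ℝ) < (j : ℝ) + 1 := by positivity
    have hS : 0 ≤ S := (mul_nonneg hj.le (hy0 i j)).trans (hi j)
    have h1 : ‖z * (y i j : ℂ)‖ = ‖z‖ * y i j := by
      rw [norm_mul, Complex.norm_real, Real.norm_eq_abs, abs_of_nonneg (hy0 i j)]
    have h2 : y i j ≤ S / ((j : ℝ) + 1) := by
      rw [le_div_iff₀ hj, mul_comm]; exact hi j
    have h3 : y i j ≤ S := by
      refine h2.trans (div_le_self hS ?_)
      linarith [Nat.cast_nonneg (α := ℝ) j]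
    rw [h1]
    have hy := hy0 i j
    calc 2 * (‖z‖ * y i j) ^ 2 * Real.exp (‖z‖ * y i j)
        ≤ 2 * (‖z‖ * (S / ((j : ℝ) + 1))) ^ 2 * Real.exp (‖z‖ * S) := by gcongr
      _ = _ := by rw [mul_div_assoc]; ring

theorem summable_mul_ofReal {Y : ℕ → ℝ} (hY : Summable Y) (z : ℂ) :
    Summable fun j => z * (Y j : ℂ) :=
  (Complex.summable_ofReal.2 hY).mul_left z

theorem multipliable_one_sub_mul {Y : ℕ → ℝ} (hY : Summable Y) (z : ℂ) :
    Multipliable fun j => 1 - z * (Y j : ℂ) := by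
  simpa [sub_eq_add_neg] using multipliable_one_add_of_summable
    (f := fun j => -(z * (Y j : ℂ))) (summable_mul_ofReal hY z).neg.norm

theorem tprod_mul_exp {Y : ℕ → ℝ} (hY : Summable Y) (z : ℂ) :
    ∏' j, (1 - z * Y j) * Complex.exp (z * Y j) =
      (∏' j, (1 - z * (Y j : ℂ))) * Complex.exp (z * (∑' j, Y j : ℝ)) := by
  have h1 : HasSum (fun j => z * (Y j : ℂ)) (z * (∑' j, Y j : ℝ)) :=
    (Complex.hasSum_ofReal.2 hY.hasSum).mul_left z
  exact ((multipliable_one_sub_mul hY z).hasProd.mul h1.cexp).tprod_eq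

theorem mem_LP_of_tprod {Y : ℕ → ℝ} (hY0 : ∀ j, 0 ≤ Y j) (hY : Summable Y) {α : ℝ} (hα : 0 ≤ α)
    {g : ℂ → ℂ} (hg : IsRealEntire g)
    (h : ∀ z, g z = Complex.exp (-(α : ℂ) * z) * ∏' j, (1 - z * (Y j : ℂ))) : g ∈ LP := by
  refine ⟨hg, 1, 0, α, {j // 0 < Y j}, inferInstance, fun j => (Y j)⁻¹, hα,
    fun j => inv_pos.2 j.2, ?_, fun z => ⟨∏' j, (1 - z * (Y j : ℂ)), ?_, ?_⟩⟩
  · simp only [inv_inv]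
    exact hY.subtype {j | 0 < Y j}
  · have h1 : Function.mulSupport (fun j => 1 - z * (Y j : ℂ)) ⊆ {j | 0 < Y j} := fun j hj => by
      by_contra hlt
      have : Y j = 0 := le_antisymm (not_lt.1 hlt) (hY0 j)
      exact hj (by simp [this])
    have h2 := (hasProd_subtype_iff_of_mulSupport_subset h1).2
      (multipliable_one_sub_mul hY z).hasProd
    refine h2.congr_fun ?_
    intro j
    simp [Function.comp, div_eq_mul_inv]
  · rw [h z]; simp

theorem summable_pow_div_factorial_mul (S r : ℝ) :
    Summable fun k : ℕ => S ^ k / (k.factorial : ℝ) * r ^ k :=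
  (Real.summable_pow_div_factorial (S * r)).congr fun k => by rw [mul_pow]; ring

theorem abs_coeff_invProd_le {s : Multiset ℝ} (hs : ∀ y ∈ s, 0 < y) {S : ℝ} (hS : s.sum ≤ S)
    (k : ℕ) : |(invProd s).coeff k| ≤ S ^ k / (k.factorial : ℝ) := by
  have h := norm_coeff_invProd_le s k
  have h1 : s.map norm = s := by
    conv_rhs => rw [← Multiset.map_id s]
    exact Multiset.map_congr rfl fun y hy => by simp [abs_of_pos (hs y hy)]
  have h0 : 0 ≤ s.sum := Multiset.sum_nonneg fun y hy => (hs y hy).le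
  rw [h1, Real.norm_eq_abs] at h
  refine h.trans ?_
  gcongr

/-- Along an ultrafilter, products `∏ (1 - y X)` with positive `y` of bounded sum converge
pointwise to a function in `LP` without zeros outside `[0, ∞)`. -/
theorem exists_tendsto_invProd {ι : Type*} (l : Ultrafilter ι) {s : ι → Multiset ℝ} {S : ℝ}
    (hs : ∀ i, ∀ y ∈ s i, 0 < y) (hS : ∀ᶠ i in (l : Filter ι), (s i).sum ≤ S) :
    ∃ g ∈ LP, (∀ z ∈ S₀ᶜ, g z ≠ 0) ∧
      ∀ z, Tendsto (fun i => evalC (invProd (s i)) z) l (𝓝 (g z)) := by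
  choose L y hy0 hyL hyj hysum hyprod using fun i => exists_antitone_enumeration (hs i)
  have hs0 : ∀ i, 0 ≤ (s i).sum := fun i => Multiset.sum_nonneg fun y hy => (hs i y hy).le
  have hyS : ∀ᶠ i in (l : Filter ι), ∀ j : ℕ, (j + 1) * y i j ≤ S :=
    hS.mono fun i hi j => (hyj i j).trans hi
  have hS0 : 0 ≤ S := by
    obtain ⟨i, hi⟩ := hS.exists
    exact (hs0 i).trans hi
  choose Y hY using fun j => exists_tendsto_of_eventually_le l (fun i => y i j) S
    (hyS.mono fun i hi => by
      have h1 := hi j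
      have h2 := hy0 i j
      rw [abs_of_nonneg h2]
      nlinarith [Nat.cast_nonneg (α := ℝ) j, mul_nonneg (Nat.cast_nonneg (α := ℝ) j) h2])
  obtain ⟨σ, hσ⟩ := exists_tendsto_of_eventually_le l (fun i => (s i).sum) S
    (hS.mono fun i hi => by rwa [abs_of_nonneg (hs0 i)])
  have hY0 : ∀ j, 0 ≤ Y j := fun j => ge_of_tendsto' (hY j) fun i => hy0 i j
  -- Mass can be lost in the limit but not created: `∑ Y_j ≤ σ = lim ∑ y`. The deficit becomes the
  -- exponent `α`.
  have hpart : ∀ u : Finset ℕ, ∑ j ∈ u, Y j ≤ σ := fun u => by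
    refine le_of_tendsto_of_tendsto' (tendsto_finsetSum u fun j _ => hY j) hσ fun i => ?_
    rw [← hysum i, ← Finset.sum_filter_add_sum_filter_not u (· < L i)]
    have h1 : ∑ j ∈ u with ¬ j < L i, y i j = 0 := Finset.sum_eq_zero fun j hj =>
      hyL i j (not_lt.1 (Finset.mem_filter.1 hj).2)
    rw [h1, add_zero]
    refine Finset.sum_le_sum_of_subset_of_nonneg (fun j hj => ?_) fun j _ _ => hy0 i j
    exact Finset.mem_range.2 (Finset.mem_filter.1 hj).2
  have hYs : Summable Y := summable_of_sum_le hY0 hpart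
  have hα : 0 ≤ σ - ∑' j, Y j := sub_nonneg.2 (hYs.tsum_le_of_sum_le hpart)
  set g : ℂ → ℂ := fun z =>
    Complex.exp (-((σ - ∑' j, Y j : ℝ) : ℂ) * z) * ∏' j, (1 - z * (Y j : ℂ)) with hg
  have hlim : ∀ z, Tendsto (fun i => evalC (invProd (s i)) z) l (𝓝 (g z)) := fun z => by
    -- The convergence factors are removed by `exp (-z ∑ y)`, whose exponent tends to `-zσ`. In the
    -- limit the factors only account for `z ∑ Y_j`, which leaves `exp (-(σ - ∑ Y_j) z)`.
    have h1 := (tendsto_tprod_mul_exp hy0 hyS hY z).mul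
      (((Complex.continuous_ofReal.tendsto _).comp hσ).const_mul (-z)).cexp
    have h2 : ∀ i, (∏' j, (1 - z * y i j) * Complex.exp (z * y i j)) *
        Complex.exp (-z * ((Complex.ofReal ∘ fun i => (s i).sum) i)) =
          evalC (invProd (s i)) z := fun i => by
      rw [tprod_eq_prod (s := Finset.range (L i)) fun j hj => by
        rw [hyL i j (by simpa using hj)]; simp]
      rw [Finset.prod_mul_distrib, hyprod, ← Complex.exp_sum, ← Finset.mul_sum,
        ← Complex.ofReal_sum, hysum, mul_assoc, ← Complex.exp_add]
      simp
    refine (h1.congr h2).trans (le_of_eq ?_)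
    congr 1
    rw [tprod_mul_exp hYs, hg, mul_assoc, ← Complex.exp_add, mul_comm]
    simp only
    congr 2
    push_cast
    ring
  have hreal : ∀ x : ℝ, (g x).im = 0 := fun x => by
    refine tendsto_nhds_unique ((Complex.continuous_im.tendsto _).comp (hlim x)) ?_
    refine tendsto_const_nhds.congr fun i => ?_
    simp [evalC_ofReal]
  -- Holomorphy comes from identifying `g` with the everywhere convergent series of the limiting
  -- coefficients.
  have hdiff : Differentiable ℂ g := by
    have hb : ∀ᶠ i in (l : Filter ι), ∀ k,
        |(invProd (s i)).coeff k| ≤ S ^ k / (k.factorial : ℝ) :=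
      hS.mono fun i hi k => abs_coeff_invProd_le (hs i) hi k
    choose e he using fun k => exists_tendsto_of_eventually_le l
      (fun i => (invProd (s i)).coeff k) _ (hb.mono fun i hi => hi k)
    obtain ⟨F, hF, hF'⟩ := exists_tendsto_evalC
      (fun r _ => summable_pow_div_factorial_mul S r) hb he
    have : g = F := funext fun z => tendsto_nhds_unique (hlim z) (hF' z)
    rw [this]
    exact differentiable_of_hasSum hF
  refine ⟨g, mem_LP_of_tprod hY0 hYs hα ⟨hdiff, hreal⟩ fun z => rfl, fun z hz => ?_, hlim⟩
  refine mul_ne_zero (Complex.exp_ne_zero _) ?_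
  have h1 := tprod_one_add_ne_zero_of_summable (f := fun j => -(z * (Y j : ℂ))) (fun j h => hz ?_)
    (summable_mul_ofReal hYs z).neg.norm
  · simpa [sub_eq_add_neg] using h1
  · have h2 : z * (Y j : ℂ) = 1 := by linear_combination -h
    refine mem_S₀_iff.2 ⟨(Y j)⁻¹, inv_nonneg.2 (hY0 j), ?_⟩
    push_cast
    exact eq_inv_of_mul_eq_one_left h2

/-! ### Coefficientwise limits of polynomials with boundedly many zeros outside `[0, ∞)` -/

theorem norm_coeff_map (p : ℝ[X]) (k : ℕ) : ‖(p.map (algebraMap ℝ ℂ)).coeff k‖ = |p.coeff k| := by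
  simp

/-- The root bound gives a uniform bound `S` on the sum of all reciprocal roots, so the product, its
positive part and `Q` all have coefficients at most `S^k / k!` and can be passed to the limit
separately. `Q(0) = 1` keeps the limit of `Q` nonzero. -/
theorem exists_hasSum_of_tendsto_coeff_invProd_mul {ι : Type*} (l : Ultrafilter ι)
    {s : ι → Multiset ℝ} {Q : ι → ℝ[X]} {B : ℕ} {b : ℕ → ℝ} (hs : ∀ i, ∀ y ∈ s i, 0 < y)
    (hQ0 : ∀ i, (Q i).coeff 0 = 1) (hQ : ∀ i, (Q i).natDegree ≤ B)
    (hb : ∀ k, Tendsto (fun i => (invProd (s i) * Q i).coeff k) l (𝓝 (b k))) :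
    ∃ g ∈ LP, (∀ z ∈ S₀ᶜ, g z ≠ 0) ∧ ∃ R : ℝ[X], R.natDegree ≤ B ∧ R ≠ 0 ∧
      ∀ z, HasSum (fun k : ℕ => ((b k : ℝ) : ℂ) * z ^ k) (evalC R z * g z) := by
  have hU' : ∀ i, ∃ U : Multiset ℂ, Multiset.card U ≤ B ∧
      (Q i).map (algebraMap ℝ ℂ) = invProd U := fun i => by
    obtain ⟨U, h1, h2⟩ := exists_eq_invProd (q := (Q i).map (algebraMap ℝ ℂ)) (by simp [hQ0 i])
    exact ⟨U, h1.trans_le (natDegree_map_le.trans (hQ i)), h2⟩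
  choose U hUB hU using hU'
  have hW : ∀ i, (invProd (s i) * Q i).map (algebraMap ℝ ℂ) =
      invProd ((s i).map Complex.ofReal + U i) := fun i => by
    rw [Polynomial.map_mul, map_invProd, hU, invProd_add]
    rfl
  have hcoeff : ∀ i k, ‖(invProd ((s i).map Complex.ofReal + U i)).coeff k‖ =
      |(invProd (s i) * Q i).coeff k| := fun i k => by rw [← hW, norm_coeff_map]
  obtain ⟨K, hK⟩ := exists_root_bound B (M₁ := |b 1| + 1) (by positivity)
  set M : ℝ := ∑ k ∈ Finset.range (K + 1), |b k| + 1 with hM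
  have hM0 : 0 ≤ M := by positivity
  have hev1 : ∀ᶠ i in (l : Filter ι), |(invProd (s i) * Q i).coeff 1| ≤ |b 1| + 1 :=
    (hb 1).abs.eventually_le_const (by linarith)
  have hev2 : ∀ᶠ i in (l : Filter ι), ∀ k ∈ Finset.range (K + 1),
      |(invProd (s i) * Q i).coeff k| ≤ M := by
    rw [Filter.eventually_all_finset]
    intro k hk
    refine (hb k).abs.eventually_le_const ?_
    have := Finset.single_le_sum (f := fun k => |b k|) (fun j _ => abs_nonneg (b j)) hk
    linarith
  set T : ℝ := 2 * K * M + 1 with hT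
  have hT0 : 0 ≤ T := by positivity
  set S : ℝ := |b 1| + 1 + 2 * (B * T) with hS
  have hevS : ∀ᶠ i in (l : Filter ι),
      (((s i).map Complex.ofReal + U i).map norm).sum ≤ S := by
    filter_upwards [hev1, hev2] with i h1 h2
    have h3 := hK (s i) (U i) M hM0 (hs i) (hUB i) (by rwa [hcoeff]) fun k hk => by
      rw [hcoeff]
      exact h2 k (Finset.mem_range.2 (Nat.lt_succ_of_le hk))
    have h4 := sum_norm_le (hs i) fun w hw => h3 w (Multiset.mem_add.2 (Or.inr hw))
    rw [hcoeff] at h4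
    have h5 : (Multiset.card (U i) : ℝ) * T ≤ B * T := by
      gcongr
      exact_mod_cast hUB i
    linarith
  have hsum : ∀ i, (((s i).map Complex.ofReal + U i).map norm).sum =
      (s i).sum + ((U i).map norm).sum := fun i => by
    rw [Multiset.map_add, Multiset.sum_add, sum_map_norm_ofReal (hs i)]
  have hs0 : ∀ i, 0 ≤ (s i).sum := fun i => Multiset.sum_nonneg fun y hy => (hs i y hy).le
  obtain ⟨g, hg, hg0, hlim⟩ := exists_tendsto_invProd l hs (S := S) (hevS.mono fun i hi => by
    rw [hsum] at hi
    linarith [sum_map_norm_nonneg (U i)])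
  obtain ⟨F, hF, hF'⟩ := exists_tendsto_evalC (l := (l : Filter ι))
    (p := fun i => invProd (s i) * Q i) (fun r _ => summable_pow_div_factorial_mul S r)
    (hevS.mono fun i hi k => by
      rw [← hcoeff]
      refine (norm_coeff_invProd_le _ k).trans ?_
      have := sum_map_norm_nonneg ((s i).map Complex.ofReal + U i)
      gcongr) hb
  have hQb : ∀ k, ∀ᶠ i in (l : Filter ι), |(Q i).coeff k| ≤ S ^ k / (k.factorial : ℝ) :=
    fun k => hevS.mono fun i hi => by
      rw [← norm_coeff_map, hU]
      refine (norm_coeff_invProd_le _ k).trans ?_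
      have := sum_map_norm_nonneg (U i)
      rw [hsum] at hi
      gcongr
      linarith [hs0 i]
  choose r hr using fun k => exists_tendsto_of_eventually_le l (fun i => (Q i).coeff k) _ (hQb k)
  set R : ℝ[X] := ∑ k ∈ Finset.range (B + 1), monomial k (r k) with hR
  have hRc : ∀ k < B + 1, R.coeff k = r k := fun k hk => by
    rw [hR, finsetSum_coeff]
    simp [coeff_monomial, hk]
  have hRdeg : R.natDegree ≤ B := natDegree_sum_le_of_forall_le _ _ fun k hk =>
    (natDegree_monomial_le _).trans (Nat.lt_succ_iff.1 (Finset.mem_range.1 hk))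
  have hRlim : ∀ z, Tendsto (fun i => evalC (Q i) z) l (𝓝 (evalC R z)) := fun z => by
    rw [evalC_eq_sum_range (Nat.lt_succ_of_le hRdeg)]
    simp_rw [fun i => evalC_eq_sum_range (Nat.lt_succ_of_le (hQ i)) z]
    refine tendsto_finsetSum _ fun k hk => ?_
    rw [hRc k (Finset.mem_range.1 hk)]
    exact ((Complex.continuous_ofReal.tendsto _).comp (hr k)).mul_const _
  refine ⟨g, hg, hg0, R, hRdeg, ?_, fun z => ?_⟩
  · intro h
    have h1 : r 0 = 1 := tendsto_nhds_unique (hr 0) (by simp [hQ0])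
    rw [← hRc 0 (Nat.succ_pos B), h] at h1
    simp at h1
  · have h1 : F z = evalC R z * g z := by
      refine tendsto_nhds_unique (hF' z) (((hRlim z).mul (hlim z)).congr fun i => ?_)
      rw [evalC_mul, mul_comm]
    rw [← h1]
    exact hF z

theorem exists_normalized_factor {p : ℝ[X]} {m B : ℕ} (hp : p.coeff m ≠ 0)
    (hlow : ∀ k < m, p.coeff k = 0) (hB : outerCount p ≤ B) :
    ∃ (s : Multiset ℝ) (Q : ℝ[X]), (∀ y ∈ s, 0 < y) ∧ Q.coeff 0 = 1 ∧ Q.natDegree ≤ B ∧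
      ∀ k, p.coeff (k + m) = p.coeff m * (invProd s * Q).coeff k := by
  have hp0 : p ≠ 0 := by rintro rfl; simp at hp
  obtain ⟨m', s, Q, hs, h, hd, hr⟩ := exists_eq_X_pow_mul_invProd_mul hp0
  have hQ0 : Q.coeff 0 ≠ 0 := by
    rw [coeff_zero_eq_eval_zero]
    exact hr 0 le_rfl
  have h1 : ∀ k, p.coeff (k + m') = (invProd s * Q).coeff k := fun k => by
    conv_lhs => rw [h]
    rw [mul_assoc, coeff_X_pow_mul]
  have h2 : p.coeff m' = Q.coeff 0 := by
    have := h1 0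
    rwa [zero_add, mul_coeff_zero, coeff_zero_invProd, one_mul] at this
  have hm : m = m' := by
    rcases lt_trichotomy m m' with hlt | heq | hgt
    · refine absurd ?_ hp
      rw [h, mul_assoc, coeff_X_pow_mul', if_neg (not_le.2 hlt)]
    · exact heq
    · exact absurd (h2 ▸ hlow m' hgt) hQ0
  subst hm
  refine ⟨s, C (Q.coeff 0)⁻¹ * Q, hs, by simp [hQ0], ?_, fun k => ?_⟩
  · rw [natDegree_C_mul (inv_ne_zero hQ0), hd]
    exact hB
  · rw [h1, h2, mul_left_comm, coeff_C_mul, mul_inv_cancel_left₀ hQ0]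

/-- If real polynomials of the same order at `0` converge coefficientwise to a formal power series
and have at most `B` zeros outside `[0, ∞)`, then the series represents a function in `LPStar`
with at most `B` zeros outside `[0, ∞)`. -/
theorem exists_represents_of_tendsto_coeff {ι : Type*} {l : Filter ι} [l.NeBot] {p : ι → ℝ[X]}
    {f : PowerSeries ℝ} {m B : ℕ} (hm : PowerSeries.coeff m f ≠ 0)
    (hp : ∀ k, Tendsto (fun i => (p i).coeff k) l (𝓝 (PowerSeries.coeff k f)))
    (hlow : ∀ i, ∀ k < m, (p i).coeff k = 0) (hB : ∀ᶠ i in l, outerCount (p i) ≤ B) :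
    ∃ F : ℂ → ℂ, Represents f F ∧ F ∈ LPStar ∧ zeroCount F S₀ᶜ ≤ B := by
  have hle : (Ultrafilter.of l : Filter ι) ≤ l := Ultrafilter.of_le l
  set a := fun k => PowerSeries.coeff k f with ha
  have hfac : ∀ i, ∃ (s : Multiset ℝ) (Q : ℝ[X]), (∀ y ∈ s, 0 < y) ∧ Q.coeff 0 = 1 ∧
      Q.natDegree ≤ B ∧ ((p i).coeff m ≠ 0 → outerCount (p i) ≤ B →
        ∀ k, (p i).coeff (k + m) = (p i).coeff m * (invProd s * Q).coeff k) := fun i => by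
    by_cases h : (p i).coeff m ≠ 0 ∧ outerCount (p i) ≤ B
    · obtain ⟨s, Q, h1, h2, h3, h4⟩ := exists_normalized_factor h.1 (hlow i) h.2
      exact ⟨s, Q, h1, h2, h3, fun _ _ => h4⟩
    · exact ⟨0, 1, by simp, by simp, by simp, fun h1 h2 => absurd ⟨h1, h2⟩ h⟩
  choose s Q hs hQ0 hQ hsQ using hfac
  have hev : ∀ᶠ i in l, (p i).coeff m ≠ 0 := (hp m).eventually_ne hm
  have hb : ∀ k, Tendsto (fun i => (invProd (s i) * Q i).coeff k) (Ultrafilter.of l)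
      (𝓝 (a (k + m) / a m)) := fun k => by
    refine Tendsto.mono_left ?_ hle
    refine ((hp (k + m)).div (hp m) hm).congr' ?_
    filter_upwards [hev, hB] with i h1 h2
    rw [Pi.div_apply, hsQ i h1 h2 k, mul_div_cancel_left₀ _ h1]
  obtain ⟨g, hg, hg0, R, hRd, hR0, hsum⟩ :=
    exists_hasSum_of_tendsto_coeff_invProd_mul (Ultrafilter.of l) hs hQ0 hQ hb
  have hlow' : ∀ k < m, a k = 0 := fun k hk =>
    tendsto_nhds_unique (hp k) (by simp [fun i => hlow i k hk])
  have heval : ∀ z, evalC (C (a m) * X ^ m * R) z = (a m : ℂ) * z ^ m * evalC R z := fun z => by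
    simp [evalC]
  have hgd : Differentiable ℂ g := hg.1.1
  refine ⟨fun z => evalC (C (a m) * X ^ m * R) z * g z, fun z => ?_, ⟨⟨?_, fun x => ?_⟩, _, g, hg,
    fun z => rfl⟩, ?_⟩
  · rw [← hasSum_nat_add_iff' m, Finset.sum_eq_zero fun k hk => by
      have := hlow' k (Finset.mem_range.1 hk)
      simp only [ha] at this
      rw [this]; simp, sub_zero]
    have h1 := (hsum z).mul_left ((a m : ℂ) * z ^ m)
    change HasSum _ (evalC _ z * g z)
    rw [heval, mul_assoc]
    refine h1.congr_fun fun k => ?_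
    have hm' : ((a m : ℝ) : ℂ) ≠ 0 := by exact_mod_cast hm
    push_cast
    rw [pow_add]
    field_simp
    simp only [ha]
    ring
  · exact (differentiable_evalC _).mul hgd
  · have := hg.1.2 x
    change (evalC _ (x : ℂ) * g x).im = 0
    rw [evalC_ofReal, Complex.im_ofReal_mul, this, mul_zero]
  · have h1 : (fun z => evalC (C (a m) * X ^ m * R) z * g z) =
        fun z => ((a m : ℂ) * z ^ m * g z) * evalC R z := by
      funext z; rw [heval]; ring
    rw [h1]
    refine (zeroCount_mul_evalC_le ?_ (fun z hz => ?_) hR0).trans (by exact_mod_cast hRd)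
    · fun_prop
    · refine mul_ne_zero (mul_ne_zero (by exact_mod_cast hm) (pow_ne_zero _ fun h => hz ?_))
        (hg0 z hz)
      simp [h, S₀]

/-! ### Reversed Appell polynomials and their limits -/

theorem natDegree_appell_le (f : PowerSeries ℝ) (n : ℕ) : (appell f n).natDegree ≤ n :=
  natDegree_sum_le_of_forall_le _ _ fun _ _ => (natDegree_monomial_le _).trans (Nat.sub_le _ _)

theorem coeff_reflect_appell (f : PowerSeries ℝ) (n k : ℕ) :
    ((appell f n).reflect n).coeff k = n.descFactorial k * PowerSeries.coeff k f := by
  rw [coeff_reflect]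
  rcases le_or_gt k n with hk | hk
  · rw [revAt_le hk, appell, finsetSum_coeff, Finset.sum_eq_single k]
    · rw [coeff_monomial, if_pos rfl, ← Nat.factorial_mul_descFactorial hk]
      have := Nat.factorial_ne_zero (n - k)
      push_cast
      field_simp
    · intro j hj hjk
      have := Finset.mem_range.1 hj
      rw [coeff_monomial, if_neg (by omega)]
    · intro h
      exact absurd (Finset.mem_range.2 (Nat.lt_succ_of_le hk)) h
  · rw [revAt_eq_self_of_lt hk, coeff_eq_zero_of_natDegree_lt
      ((natDegree_appell_le f n).trans_lt hk), Nat.descFactorial_of_lt hk]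
    simp

theorem outerCount_reflect_appell (f : PowerSeries ℝ) (n : ℕ) :
    outerCount ((appell f n).reflect n) = outerCount (appell f n) := by
  refine le_antisymm (outerCount_reflect_le (natDegree_appell_le f n)) ?_
  have h := outerCount_reflect_le (p := (appell f n).reflect n) (n := n)
    (natDegree_reflect_le.trans (max_le le_rfl (natDegree_appell_le f n)))
  rwa [reflect_reflect] at h

theorem tendsto_descFactorial_div_pow (k : ℕ) :
    Tendsto (fun n : ℕ => (n.descFactorial k : ℝ) / (n : ℝ) ^ k) atTop (𝓝 1) := by
  refine (Asymptotics.isEquivalent_iff_tendsto_one ?_).1 (isEquivalent_descFactorial k)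
  filter_upwards [eventually_gt_atTop 0] with n hn
  positivity

theorem Represents.unique {f : PowerSeries ℝ} {F G : ℂ → ℂ} (hF : Represents f F)
    (hG : Represents f G) : F = G := funext fun z => (hF z).unique (hG z)

theorem Represents.coeff_eq {f g : PowerSeries ℝ} {F : ℂ → ℂ} (hf : Represents f F)
    (hg : Represents g F) : f = g := by
  ext k
  have := congrFun (coeff_unique_of_hasSum hf hg) k
  exact_mod_cast this

/-- A nonzero series whose Appell polynomials eventually have at most `B` zeros outside `[0, ∞)`
represents a function in `LPStar` with at most `B` zeros outside `[0, ∞)`. -/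
theorem exists_represents_of_outerCount_appell_le {f : PowerSeries ℝ} (hf : f ≠ 0) {B : ℕ}
    (hB : ∀ᶠ n in atTop, outerCount (appell f n) ≤ B) :
    ∃ F : ℂ → ℂ, Represents f F ∧ F ∈ LPStar ∧ zeroCount F S₀ᶜ ≤ B := by
  -- The classical Jensen-type approximants `∑ n!/((n-k)! n^k) a_k x^k`.
  set p : ℕ → ℝ[X] := fun n => ((appell f n).reflect n).comp (C (n : ℝ)⁻¹ * X) with hp
  have hcoeff : ∀ n k, (p n).coeff k =
      (n.descFactorial k : ℝ) / (n : ℝ) ^ k * PowerSeries.coeff k f := fun n k => by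
    rw [hp]
    simp only
    rw [comp_C_mul_X_coeff, coeff_reflect_appell, inv_pow]
    ring
  refine exists_represents_of_tendsto_coeff (l := atTop) (p := p) (m := f.order.toNat)
    (PowerSeries.coeff_order hf) (fun k => ?_) (fun n k hk => ?_) ?_
  · simp_rw [hcoeff]
    simpa using (tendsto_descFactorial_div_pow k).mul_const (PowerSeries.coeff k f)
  · rw [hcoeff, PowerSeries.coeff_of_lt_order_toNat k hk, mul_zero]
  · filter_upwards [hB, eventually_gt_atTop 0] with n hn hn0
    refine (outerCount_comp_le (by positivity) _).trans ?_
    rwa [outerCount_reflect_appell]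

theorem outerCount_iterate_derivative_le (p : ℝ[X]) (d : ℕ) :
    outerCount (derivative^[d] p) ≤ outerCount p := by
  induction d with
  | zero => rfl
  | succ d ih =>
    rw [Function.iterate_succ_apply']
    exact (outerCount_derivative_le _).trans ih

/-- The polynomial with coefficients `n!/(n-k)! * M^k (M-k)!/M! * p_k`. -/
theorem exists_truncation (p : ℝ[X]) {n M : ℕ} (hn : n ≤ M) (hp : p.natDegree ≤ M) (hM : 0 < M) :
    ∃ q : ℝ[X], outerCount q ≤ outerCount p ∧ ∀ k, q.coeff k =
      n.descFactorial k * ((M.descFactorial k : ℝ) / (M : ℝ) ^ k)⁻¹ * p.coeff k := by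
  -- After reversal at `M`, differentiating `M - n` times removes the coefficients with `k > n` and
  -- multiplies the others by `(M-k)!/(n-k)!`; reversal at `n` restores the order. Each operation
  -- respects the outer count.
  set r := derivative^[M - n] (p.reflect M) with hr
  have hrd : r.natDegree ≤ n := by
    refine (natDegree_iterate_derivative _ _).trans ?_
    have : (p.reflect M).natDegree ≤ M := natDegree_reflect_le.trans (max_le le_rfl hp)
    omega
  have hc : ((n.factorial : ℝ) / M.factorial) ≠ 0 :=
    div_ne_zero (by exact_mod_cast n.factorial_ne_zero) (by exact_mod_cast M.factorial_ne_zero)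
  refine ⟨C ((n.factorial : ℝ) / M.factorial) * (r.reflect n).comp (C (M : ℝ) * X), ?_,
    fun k => ?_⟩
  · rw [outerCount_C_mul hc]
    exact (outerCount_comp_le (by exact_mod_cast hM) _).trans <| (outerCount_reflect_le hrd).trans <|
      (outerCount_iterate_derivative_le _ _).trans (outerCount_reflect_le hp)
  · rw [coeff_C_mul, comp_C_mul_X_coeff, coeff_reflect]
    rcases le_or_gt k n with hk | hk
    · rw [revAt_le hk, hr, coeff_iterate_derivative]
      have h1 : n - k + (M - n) = M - k := by omega
      have h2 : M - k - (M - n) = n - k := by omega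
      have h3 := Nat.factorial_mul_descFactorial (show M - n ≤ M - k by omega)
      have h4 := Nat.factorial_mul_descFactorial hk
      have h5 := Nat.factorial_mul_descFactorial (hk.trans hn)
      rw [h2] at h3
      rw [h1, coeff_reflect, revAt_le (Nat.sub_le _ _), Nat.sub_sub_self (hk.trans hn), nsmul_eq_mul,
        ← h4, ← h5, ← h3]
      have e1 : ((n - k).factorial : ℝ) ≠ 0 := by exact_mod_cast Nat.factorial_ne_zero _
      have e2 : ((M - k).descFactorial (M - n) : ℝ) ≠ 0 := by
        have : (M - k).descFactorial (M - n) ≠ 0 := by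
          rw [Ne, Nat.descFactorial_eq_zero_iff_lt]; omega
        exact_mod_cast this
      have e3 : (M.descFactorial k : ℝ) ≠ 0 := by
        have : M.descFactorial k ≠ 0 := by
          rw [Ne, Nat.descFactorial_eq_zero_iff_lt]; omega
        exact_mod_cast this
      have e4 : (M : ℝ) ≠ 0 := by exact_mod_cast hM.ne'
      push_cast
      field_simp
    · rw [revAt_eq_self_of_lt hk, coeff_eq_zero_of_natDegree_lt (hrd.trans_lt hk),
        Nat.descFactorial_of_lt hk]
      simp

/-- If a series is a coefficientwise limit of polynomials of the same order at `0` with at most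
`B` zeros outside `[0, ∞)`, then so has each of its Appell polynomials. -/
theorem outerCount_appell_le_of_tendsto_coeff {ι : Type*} {l : Filter ι} [l.NeBot]
    {p : ι → ℝ[X]} {f : PowerSeries ℝ} {m B : ℕ} (hm : PowerSeries.coeff m f ≠ 0)
    (hp : ∀ k, Tendsto (fun i => (p i).coeff k) l (𝓝 (PowerSeries.coeff k f)))
    (hlow : ∀ i, ∀ k < m, (p i).coeff k = 0) (hB : ∀ i, outerCount (p i) ≤ B) (n : ℕ) :
    outerCount (appell f n) ≤ B := by
  -- If `n < m`, truncation kills the leading term and `A(f, n) = 0`; otherwise the order `m`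
  -- survives, as the compactness theorem requires.
  rcases lt_or_ge n m with hnm | hnm
  · have : appell f n = 0 := Finset.sum_eq_zero fun k hk => by
      have hk' : k < m := (Nat.lt_succ_iff.1 (Finset.mem_range.1 hk)).trans_lt hnm
      have h0 : PowerSeries.coeff k f = 0 :=
        tendsto_nhds_unique (hp k) (by simp [fun i => hlow i k hk'])
      simp [h0]
    simp [this, outerCount]
  -- `M` must exceed `n` and the degree of the current polynomial, and also tend to infinity so that
  -- `M^k (M-k)!/M!` tends to `1`; the second index provides this freedom.
  set M : ι × ℕ → ℕ := fun x => (p x.1).natDegree + n + x.2 + 1 with hM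
  choose q hqB hq using fun x : ι × ℕ => exists_truncation (p x.1) (n := n) (M := M x)
    (by simp only [hM]; omega) (by simp only [hM]; omega) (by simp only [hM]; omega)
  have hMt : Tendsto M (l ×ˢ atTop) atTop :=
    tendsto_atTop_mono (fun x => by simp only [hM]; omega) tendsto_snd
  set h : PowerSeries ℝ := PowerSeries.mk fun k => n.descFactorial k * PowerSeries.coeff k f with hh
  have hqt : ∀ k, Tendsto (fun x => (q x).coeff k) (l ×ˢ atTop) (𝓝 (PowerSeries.coeff k h)) :=
    fun k => by
      simp_rw [hq, hh, PowerSeries.coeff_mk]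
      have h1 := ((tendsto_descFactorial_div_pow k).comp hMt).inv₀ one_ne_zero
      simpa using (h1.const_mul (n.descFactorial k : ℝ)).mul ((hp k).comp tendsto_fst)
  have hhm : PowerSeries.coeff m h ≠ 0 := by
    rw [hh, PowerSeries.coeff_mk]
    refine mul_ne_zero ?_ hm
    rw [Nat.cast_ne_zero, Ne, Nat.descFactorial_eq_zero_iff_lt]
    omega
  obtain ⟨F, hF, -, hFB⟩ := exists_represents_of_tendsto_coeff (B := B) hhm hqt
    (fun x k hk => by rw [hq, hlow _ k hk, mul_zero])
    (Eventually.of_forall fun x => (hqB x).trans (hB x.1))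
  have h1 : Represents h (evalC ((appell f n).reflect n)) := fun z => by
    rw [evalC_eq_sum_range (Nat.lt_succ_self _)]
    simp_rw [hh, PowerSeries.coeff_mk, ← coeff_reflect_appell]
    refine hasSum_sum_of_ne_finset_zero fun k hk => ?_
    rw [coeff_eq_zero_of_natDegree_lt (by simpa using hk)]
    simp
  -- The limit is itself the reversed Appell polynomial, so the bound on its zero count is the
  -- desired one.
  rw [hF.unique h1, zeroCount_evalC, outerCount_reflect_appell] at hFB
  exact_mod_cast hFB

/-! ### Functions in `LPStar` as limits of polynomials -/

theorem evalC_invProd_replicate (M : ℕ) (α : ℝ) (z : ℂ) :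
    evalC (invProd (Multiset.replicate M (α / M))) z = (1 + (-(α : ℂ) * z) / M) ^ M := by
  simp only [evalC, invProd, Multiset.map_replicate, Multiset.prod_replicate, map_pow, map_sub,
    map_one, map_mul, aeval_C, aeval_X, Complex.coe_algebraMap]
  push_cast
  ring

theorem evalC_invProd_finset {ι : Type*} (a : ι → ℝ) (t : Finset ι) (z : ℂ) :
    evalC (invProd (t.val.map fun j => (a j)⁻¹)) z = ∏ j ∈ t, (1 - z / (a j : ℂ)) := by
  simp only [evalC, invProd, Multiset.map_map, map_multiset_prod, Finset.prod]
  congr 1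
  refine Multiset.map_congr rfl fun j _ => ?_
  simp [div_eq_inv_mul]

/-- Partial products of the zeros times `(1 - αz/M)^M` approximate `g` by polynomials with
nonnegative zeros only, so multiplying by `P` gives approximants of `F` with at most `outerCount P`
outer zeros. -/
theorem outerCount_appell_le {f : PowerSeries ℝ} {F : ℂ → ℂ} (hf : Represents f F) (hF : F ≠ 0)
    {P : ℝ[X]} {g : ℂ → ℂ} (hg : g ∈ LP) (hFg : ∀ z, F z = evalC P z * g z) (n : ℕ) :
    outerCount (appell f n) ≤ outerCount P := by
  obtain ⟨-, c, m, α, ι, -, a, hα, ha, hsum, hprod⟩ := hg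
  have hP : P ≠ 0 := by
    rintro rfl
    exact hF (funext fun z => by simp [hFg, evalC])
  have hc : c ≠ 0 := by
    rintro rfl
    refine hF (funext fun z => ?_)
    obtain ⟨p, -, hp⟩ := hprod z
    simp [hFg, hp]
  set A : ℝ[X] := X ^ m * (C c * P) with hA
  have hA0 : A ≠ 0 := mul_ne_zero (pow_ne_zero _ X_ne_zero) (mul_ne_zero (C_ne_zero.2 hc) hP)
  -- For `α = 0` the exponential factor is left out, since its entries `α/M` would not be positive.
  set T : Finset ι × ℕ → Multiset ℝ := fun x =>
    (x.1.val.map fun j => (a j)⁻¹) + if α = 0 then 0 else Multiset.replicate x.2 (α / x.2) with hT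
  set S : ℝ := ∑' j, (a j)⁻¹ + α with hS
  have hTpos : ∀ x, ∀ y ∈ T x, 0 < y := fun x y hy => by
    rcases Multiset.mem_add.1 hy with h | h
    · obtain ⟨j, -, rfl⟩ := Multiset.mem_map.1 h
      exact inv_pos.2 (ha j)
    · split_ifs at h with h0
      · simp at h
      · obtain ⟨h1, rfl⟩ := Multiset.mem_replicate.1 h
        exact div_pos (lt_of_le_of_ne hα (Ne.symm h0)) (by exact_mod_cast Nat.pos_of_ne_zero h1)
  have hTsum : ∀ x, (T x).sum ≤ S := fun x => by
    rw [hT, hS]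
    simp only [Multiset.sum_add]
    refine add_le_add (hsum.sum_le_tsum x.1 fun j _ => (inv_pos.2 (ha j)).le) ?_
    split_ifs with h0
    · simpa using hα
    · rw [Multiset.sum_replicate, nsmul_eq_mul]
      rcases eq_or_ne x.2 0 with h1 | h1
      · simpa [h1] using hα
      · rw [mul_div_cancel₀]
        exact_mod_cast h1
  set φ : Finset ι × ℕ → ℝ[X] := fun x => A * invProd (T x) with hφ
  -- Coefficients of the Cauchy product of `∑ |A_k| z^k` with `e^{Sz}`: a majorant common to all
  -- approximants.
  set u : ℕ → ℝ := fun k =>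
    ∑ x ∈ Finset.HasAntidiagonal.antidiagonal k, |A.coeff x.1| * (S ^ x.2 / (x.2.factorial : ℝ)) with hu
  have hS0 : 0 ≤ S := add_nonneg (tsum_nonneg fun j => (inv_pos.2 (ha j)).le) hα
  have husum : ∀ r : ℝ, 0 ≤ r → Summable fun k => u k * r ^ k := fun r hr => by
    have h1 : Summable fun k => |A.coeff k| * r ^ k :=
      summable_of_ne_finset_zero (s := Finset.range (A.natDegree + 1)) fun k hk => by
        rw [coeff_eq_zero_of_natDegree_lt (by simpa using hk)]
        simp
    have h2 := summable_norm_sum_mul_antidiagonal_of_summable_norm h1.norm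
      (summable_pow_div_factorial_mul S r).norm
    refine h2.of_norm.congr fun k => ?_
    rw [hu, Finset.sum_mul]
    refine Finset.sum_congr rfl fun x hx => ?_
    rw [← Finset.HasAntidiagonal.mem_antidiagonal.1 hx, pow_add]
    ring
  have hφu : ∀ x k, |(φ x).coeff k| ≤ u k := fun x k => by
    rw [hφ]
    simp only [coeff_mul]
    refine (Finset.abs_sum_le_sum_abs _ _).trans (Finset.sum_le_sum fun y _ => ?_)
    rw [abs_mul]
    gcongr
    exact abs_coeff_invProd_le (hTpos x) (hTsum x) _
  set l := Ultrafilter.of ((atTop : Filter (Finset ι)) ×ˢ (atTop : Filter ℕ)) with hl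
  have hle : (l : Filter (Finset ι × ℕ)) ≤ atTop ×ˢ atTop := Ultrafilter.of_le _
  choose b hb using fun k => exists_tendsto_of_eventually_le l (fun x => (φ x).coeff k) (u k)
    (Eventually.of_forall fun x => hφu x k)
  obtain ⟨G, hG, hG'⟩ := exists_tendsto_evalC husum (Eventually.of_forall hφu) hb
  have hlim : ∀ z, Tendsto (fun x => evalC (φ x) z) l (𝓝 (F z)) := fun z => by
    obtain ⟨p, hp, hgz⟩ := hprod z
    have h1 : Tendsto (fun x : Finset ι × ℕ => ∏ j ∈ x.1, (1 - z / (a j : ℂ))) l (𝓝 p) :=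
      (Tendsto.comp (hp : Tendsto _ _ _) tendsto_fst).mono_left hle
    have h2 : Tendsto (fun x : Finset ι × ℕ => (1 + (-(α : ℂ) * z) / (x.2 : ℂ)) ^ x.2) l
        (𝓝 (Complex.exp (-(α : ℂ) * z))) :=
      ((Complex.tendsto_one_add_div_pow_exp _).comp tendsto_snd).mono_left hle
    have h3 := (h1.mul h2).const_mul (evalC A z)
    have h4 : F z = evalC A z * (p * Complex.exp (-(α : ℂ) * z)) := by
      rw [hFg, hgz, hA]
      simp only [evalC, map_mul, map_pow, aeval_X, aeval_C, Complex.coe_algebraMap]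
      ring
    rw [h4]
    refine h3.congr fun x => ?_
    rw [hφ]
    simp only [hT, invProd_add, evalC_mul, evalC_invProd_finset]
    congr 2
    split_ifs with h0
    · simp [h0, invProd_zero, evalC]
    · rw [evalC_invProd_replicate]
  -- Pointwise convergence to `F` identifies the coefficient limits with those of `f`, by uniqueness
  -- of power series.
  have hGF : G = F := funext fun z => tendsto_nhds_unique (hG' z) (hlim z)
  have hfb : f = PowerSeries.mk b := hf.coeff_eq fun z => by
    simpa [hGF] using hG z
  have hb' : ∀ k, Tendsto (fun x => (φ x).coeff k) l (𝓝 (PowerSeries.coeff k f)) := fun k => by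
    rw [hfb, PowerSeries.coeff_mk]
    exact hb k
  have hφlow : ∀ x, ∀ k < A.natTrailingDegree, (φ x).coeff k = 0 := fun x k hk => by
    rw [hφ]
    simp only [coeff_mul]
    refine Finset.sum_eq_zero fun y hy => ?_
    rw [coeff_eq_zero_of_lt_natTrailingDegree, zero_mul]
    have := Finset.HasAntidiagonal.mem_antidiagonal.1 hy
    omega
  have hφm : ∀ x, (φ x).coeff A.natTrailingDegree = A.trailingCoeff := fun x => by
    have h0 : (invProd (T x)).natTrailingDegree = 0 := by
      rw [natTrailingDegree_eq_zero]
      right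
      rw [coeff_zero_invProd]
      exact one_ne_zero
    have h1 := coeff_mul_natTrailingDegree_add_natTrailingDegree (p := A) (q := invProd (T x))
    rwa [trailingCoeff, trailingCoeff, h0, add_zero, coeff_zero_invProd, mul_one] at h1
  refine outerCount_appell_le_of_tendsto_coeff (l := (l : Filter (Finset ι × ℕ))) (p := φ)
    (m := A.natTrailingDegree) ?_ hb' hφlow (fun x => ?_) n
  · have h1 : PowerSeries.coeff A.natTrailingDegree f = A.trailingCoeff :=
      tendsto_nhds_unique (hb' _) (by simp [hφm])
    rw [h1]
    exact trailingCoeff_nonzero_iff_nonzero.2 hA0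
  · have h1 : φ x = X ^ m * invProd (T x) * (C c * P) := by
      simp only [hφ, hA]; ring
    rw [h1, ← outerCount_C_mul hc P]
    exact outerCount_mul_le_outerCount (hTpos x) m (mul_ne_zero (C_ne_zero.2 hc) hP)

theorem represents_zero : Represents 0 0 := fun z => by simp

theorem zero_mem_LPStar : (0 : ℂ → ℂ) ∈ LPStar := by
  have h : IsRealEntire 0 := ⟨differentiable_const 0, fun x => by simp⟩
  exact ⟨h, 0, 0, ⟨h, 0, 0, 0, Empty, inferInstance, fun _ => 1, le_rfl, fun _ => one_pos,
    (hasSum_empty).summable, fun z => ⟨1, hasProd_empty, by simp⟩⟩, fun z => by simp⟩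

theorem appell_zero (n : ℕ) : appell 0 n = 0 := by simp [appell]

theorem appellCount_of_represents {f : PowerSeries ℝ} {F : ℂ → ℂ} (hf : Represents f F)
    (hF : F ∈ LPStar) :
    (∀ n : ℕ, appellCount f n ≤ zeroCount F S₀ᶜ) ∧
      ∃ n₀ : ℕ, ∀ n : ℕ, n₀ ≤ n → appellCount f n = zeroCount F S₀ᶜ := by
  rcases eq_or_ne F 0 with rfl | hF0
  · have : f = 0 := hf.coeff_eq represents_zero
    subst this
    have h : ∀ n, appellCount 0 n = 0 := fun n => by
      simp [appellCount_eq, appell_zero, outerCount]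
    simp [h, zeroCount]
  obtain ⟨-, P, g, hg, hFg⟩ := hF
  have hle : ∀ n, outerCount (appell f n) ≤ outerCount P :=
    outerCount_appell_le hf hF0 hg hFg
  have hFeq : F = fun z => evalC P z * g z := funext hFg
  have hPF : (outerCount P : ℕ∞) ≤ zeroCount F S₀ᶜ := by
    rw [hFeq]
    exact outerCount_le_zeroCount_mul hg.1.1 (hFeq ▸ hF0)
  have hle' : ∀ n, appellCount f n ≤ zeroCount F S₀ᶜ := fun n => by
    rw [appellCount_eq]
    exact le_trans (by exact_mod_cast hle n) hPF
  refine ⟨hle', ?_⟩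
  have hbdd : BddAbove (Set.range fun n => outerCount (appell f n)) :=
    ⟨_, by rintro _ ⟨n, rfl⟩; exact hle n⟩
  -- The maximum of the bounded counts is attained at `n₀`. Taken as the bound in the compactness
  -- result, it forces `N(F) ≤ N_{n₀}`, and monotonicity gives equality from there on.
  obtain ⟨n₀, hn₀⟩ := Nat.sSup_mem (Set.range_nonempty fun n => outerCount (appell f n)) hbdd
  have hmax : ∀ n, outerCount (appell f n) ≤ outerCount (appell f n₀) := fun n => by
    simp only at hn₀
    rw [hn₀]
    exact le_csSup hbdd ⟨n, rfl⟩
  have hf0 : f ≠ 0 := by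
    rintro rfl
    exact hF0 (hf.unique represents_zero)
  obtain ⟨F', hF', -, hcount⟩ := exists_represents_of_outerCount_appell_le hf0
    (Eventually.of_forall hmax)
  rw [hF'.unique hf, ← appellCount_eq] at hcount
  exact ⟨n₀, fun n hn => le_antisymm (hle' n)
    (hcount.trans (monotone_nat_of_le_succ (appellCount_le_succ f) hn))⟩

end PolyaAppell

theorem theorem3p5 (f : PowerSeries ℝ) :
    -- part (1)
    (PolyaAppell.appellCount f 0 = 0 ∧
      ∀ n : ℕ, PolyaAppell.appellCount f n ≤ PolyaAppell.appellCount f (n + 1)) ∧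
    -- part (2)
    (∀ F : ℂ → ℂ, PolyaAppell.Represents f F → F ∈ PolyaAppell.LPStar →
      (∀ n : ℕ, PolyaAppell.appellCount f n ≤ PolyaAppell.zeroCount F PolyaAppell.S₀ᶜ) ∧
      ∃ n₀ : ℕ, ∀ n : ℕ, n₀ ≤ n →
        PolyaAppell.appellCount f n = PolyaAppell.zeroCount F PolyaAppell.S₀ᶜ) ∧
    -- part (3)
    ((∃ B : ℕ, ∀ n : ℕ, PolyaAppell.appellCount f n ≤ (B : ℕ∞)) →
      ∃ F : ℂ → ℂ, PolyaAppell.Represents f F ∧ F ∈ PolyaAppell.LPStar) := by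
  refine ⟨⟨PolyaAppell.appellCount_zero f, PolyaAppell.appellCount_le_succ f⟩,
    fun F hf hF => PolyaAppell.appellCount_of_represents hf hF, ?_⟩
  rintro ⟨B, hB⟩
  rcases eq_or_ne f 0 with rfl | hf
  · exact ⟨0, PolyaAppell.represents_zero, PolyaAppell.zero_mem_LPStar⟩
  obtain ⟨F, h1, h2, -⟩ := PolyaAppell.exists_represents_of_outerCount_appell_le (B := B) hf
    (Filter.Eventually.of_forall fun n => by
      have := hB n
      rw [PolyaAppell.appellCount_eq] at this
      exact_mod_cast this)
  exact ⟨F, h1, h2⟩
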